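/- **Setting.** Consider the plant $\dot x = Ax+Bu+w$, $y=Cx+v$ with state dimension $n=2$ and scalar $u,y$, where $w,v$ are independent white Gaussian noises with intensity matrices $W,V$, and controllers $\dot\xi=A_{\mathsf K}\xi+B_{\mathsf K}y$, $u=C_{\mathsf K}\xi$ with $\xi\in\mathbb R^2$, identified with ${\mathsf K}=\begin{bmatrix}0&C_{\mathsf K}\\B_{\mathsf K}&A_{\mathsf K}\end{bmatrix}$ in the linear space $\mathcal V_2\subset\mathbb R^{3\times3}$ of matrices with zero $(1,1)$ entry, equipped with the Frobenius inner product. The controller is stabilizing if all eigenvalues of $A_{\rm cl}=\begin{bmatrix}A&BC_{\mathsf K}\\B_{\mathsf K}C&A_{\mathsf K}\end{bmatrix}$ have negative real part. Its LQG cost is $$J({\mathsf K})=\lim_{T\to\infty}\frac1T\int_0^T\mathbb E\big[x^{\mathsf T}Qx+u^{\mathsf T}Ru\big]\,dt ,$$ where the closed-loop state $(x,\xi)$ starts at an arbitrary fixed point $z_0\in\mathbb R^4$; thus $(x(t),\xi(t))$ is Gaussian with mean $e^{A_{\rm cl}t}z_0$ and covariance $\int_0^t e^{A_{\rm cl}(t-s)}\begin{bmatrix}W&0\\0&B_{\mathsf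 K}VB_{\mathsf K}^{\mathsf T}\end{bmatrix}e^{A_{\rm cl}^{\mathsf T}(t-s)}ds$. For $\epsilon>0$ take $$A=\tfrac32\begin{bmatrix}-1&0\\0&-1-\epsilon\end{bmatrix},\; B=\begin{bmatrix}1\\1+\epsilon\end{bmatrix},\; C=\begin{bmatrix}1&1\end{bmatrix},\; Q=\begin{bmatrix}4&1\\1&4\end{bmatrix},\; W=\begin{bmatrix}4&1+\epsilon\\1+\epsilon&4(1+\epsilon)^2\end{bmatrix},\; V=R=1,$$ and the controller given by the solutions $P=\operatorname{diag}(1,1+\epsilon)$, $S=\operatorname{diag}(1,\tfrac1{1+\epsilon})$ of the two Riccati equations $AP+PA^{\mathsf T}-PC^{\mathsf T}V^{-1}CP+W=0$ and $A^{\mathsf T}S+SA-SBR^{-1}B^{\mathsf T}S+Q=0$, $${\mathsf K}^\ast=\begin{bmatrix}0&-R^{-1}B^{\mathsf T}S\\PC^{\mathsf T}V^{-1}&A-BR^{-1}B^{\mathsf T}S-PC^{\mathsf T}V^{-1}C\end{bmatrix}=\begin{bmatrix}0&-1&-1\\1&-\frac72&-2\\1+\epsilon&-2(1+\epsilon)&-\frac72(1+\epsilon)\end{bmatrix}.$$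 Let $\operatorname{Hess}_{{\mathsf K}^\ast}$ be the Hessian bilinear form of $J$ on $\mathcal V_2$ at ${\mathsf K}^\ast$, and let $\mathcal{TO}$ be the tangent space at ${\mathsf K}^\ast$ of the orbit $\left\{\begin{bmatrix}0&C^\ast_{\mathsf K}T^{-1}\\TB^\ast_{\mathsf K}&TA^\ast_{\mathsf K}T^{-1}\end{bmatrix} : T\in\mathrm{GL}_2(\mathbb R)\right\}$, where $A^\ast_{\mathsf K},B^\ast_{\mathsf K},C^\ast_{\mathsf K}$ are the blocks of ${\mathsf K}^\ast$. Let $\mathcal{TO}^\perp$ be its orthogonal complement in $\mathcal V_2$. Put $$\operatorname{rcond}_{{\mathsf K}^\ast}=\frac{\min_{0\ne\Delta\in\mathcal{TO}^\perp}\operatorname{Hess}_{{\mathsf K}^\ast}(\Delta,\Delta)/\|\Delta\|_F^2}{\max_{0\ne\Delta\in\mathcal{TO}^\perp}\operatorname{Hess}_{{\mathsf K}^\ast}(\Delta,\Delta)/\|\Delta\|_F^2},\qquad \Delta_0=\begin{bmatrix}0&0&0\\0&-\frac12&\frac12\\0&\frac12&-\frac12\end{bmatrix},\qquad \Delta_1=\begin{bmatrix}0&-\frac12&-\frac12\\\frac12&0&0\\\frac12&0&0\end{bmatrix}.$$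 **Theorem.** For every $\epsilon>0$, all controllers in a neighbourhood of ${\mathsf K}^\ast$ in $\mathcal V_2$ are stabilizing, the limit defining $J$ exists there, and $J$ is $C^\infty$ at ${\mathsf K}^\ast$. For $i=0,1$, $\operatorname{Hess}_{{\mathsf K}^\ast}(\Delta_i,\Delta_i)=\frac{d^2}{dt^2}J({\mathsf K}^\ast+t\Delta_i)\big|_{t=0}$. As $\epsilon\to0^+$, $$\operatorname{Hess}_{{\mathsf K}^\ast}(\Delta_0,\Delta_0)=\tfrac{3}{7000}\epsilon^4+o(\epsilon^4),\qquad \operatorname{Hess}_{{\mathsf K}^\ast}(\Delta_1,\Delta_1)=\tfrac{680}{343}+o(1),\qquad \|\operatorname{Proj}_{\mathcal{TO}}[\Delta_0]\|_F=O(\epsilon).$$ Consequently, for every $\epsilon>0$ the minimum and the maximum above are attained, the maximum is positive, $\|\Delta_0\|_F^2-\|\operatorname{Proj}_{\mathcal{TO}}[\Delta_0]\|_F^2>0$, and, with the asymptotics as $\epsilon\to0^+$, $$\min_{0\ne\Delta\in\mathcal{TO}^\perp}\frac{\operatorname{Hess}_{{\mathsf K}^\ast}(\Delta,\Delta)}{\|\Delta\|_F^2}\le\frac{\operatorname{Hess}_{{\mathsf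 K}^\ast}(\Delta_0,\Delta_0)}{\|\Delta_0\|_F^2-\|\operatorname{Proj}_{\mathcal{TO}}[\Delta_0]\|_F^2}=\tfrac{3}{7000}\epsilon^4+o(\epsilon^4),$$ $$\max_{0\ne\Delta\in\mathcal{TO}^\perp}\frac{\operatorname{Hess}_{{\mathsf K}^\ast}(\Delta,\Delta)}{\|\Delta\|_F^2}\ge\frac{\operatorname{Hess}_{{\mathsf K}^\ast}(\Delta_1,\Delta_1)}{\|\Delta_1\|_F^2}=\tfrac{680}{343}+o(1),$$ $$\operatorname{rcond}_{{\mathsf K}^\ast}\le\tfrac{147}{680000}\epsilon^4+o(\epsilon^4).$$ -/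

import Mathlib

open Filter Topology MeasureTheory ProbabilityTheory Asymptotics
open scoped Matrix ContDiff

noncomputable section

/-! ## The LQG problem -/

/-- Data of a continuous-time LQG problem with plant `ẋ = A x + B u + w`, `y = C x + v`, where `w`
and `v` are independent white Gaussian noises with intensity matrices `W` and `V`, and with the
running cost `xᵀ Q x + uᵀ R u`. -/
structure LQGData (n m p : Type) where
  A : Matrix n n ℝ
  B : Matrix n m ℝ
  C : Matrix p n ℝ
  Q : Matrix n n ℝ
  R : Matrix m m ℝ
  W : Matrix n n ℝ
  V : Matrix p p ℝ

/-- The real linear space `𝒱_q` of block matrices `[0, C_K; B_K, A_K]`, coordinatised by the entries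
of `C_K`, `B_K`, `A_K`. Its Euclidean inner product and norm are the Frobenius inner product
`tr (Uᵀ Δ)` and the Frobenius norm of the block matrix.
It parametrises the controllers `ξ' = A_K ξ + B_K y`, `u = C_K ξ`. -/
abbrev Controller (m p q : Type) : Type :=
  EuclideanSpace ℝ ((m × q) ⊕ (q × p) ⊕ (q × q))

namespace Controller

variable {m p q : Type}

/-- The controller `[0, C; B, A]`. -/
def ofBlocks (C : Matrix m q ℝ) (B : Matrix q p ℝ) (A : Matrix q q ℝ) : Controller m p q :=
  WithLp.toLp 2
    (Sum.elim (fun i => C i.1 i.2) (Sum.elim (fun i => B i.1 i.2) (fun i => A i.1 i.2)))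

/-- The block `C_K`. -/
def CK (K : Controller m p q) : Matrix m q ℝ := Matrix.of fun i j => K (Sum.inl (i, j))

/-- The block `B_K`. -/
def BK (K : Controller m p q) : Matrix q p ℝ := Matrix.of fun i j => K (Sum.inr (Sum.inl (i, j)))

/-- The block `A_K`. -/
def AK (K : Controller m p q) : Matrix q q ℝ := Matrix.of fun i j => K (Sum.inr (Sum.inr (i, j)))

/-- Similarity transformation `𝒯(T, K) = [0, C_K T⁻¹; T B_K, T A_K T⁻¹]`. -/
def similarity [Fintype q] [DecidableEq q] (T : GL q ℝ) (K : Controller m p q) :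
    Controller m p q :=
  ofBlocks (K.CK * (↑T⁻¹ : Matrix q q ℝ)) ((↑T : Matrix q q ℝ) * K.BK)
    ((↑T : Matrix q q ℝ) * K.AK * (↑T⁻¹ : Matrix q q ℝ))

/-- The orbit `𝒪_K` of a controller under similarity transformations. -/
def orbit [Fintype q] [DecidableEq q] (K : Controller m p q) : Set (Controller m p q) :=
  Set.range fun T : GL q ℝ => similarity T K

end Controller

namespace LQGData

variable {n m p q : Type} [Fintype n] [Fintype m] [Fintype p] [Fintype q]
  [DecidableEq n] [DecidableEq m] [DecidableEq p] [DecidableEq q]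

/-- The closed-loop matrix `[A, B C_K; B_K C, A_K]`, acting on the joint state `(x, ξ)`. -/
def closedLoop (D : LQGData n m p) (K : Controller m p q) : Matrix (n ⊕ q) (n ⊕ q) ℝ :=
  Matrix.fromBlocks D.A (D.B * K.CK) (K.BK * D.C) K.AK

/-- Intensity matrix `[W, 0; 0, B_K V B_Kᵀ]` of the noise `(w, B_K v)` in the closed loop. -/
def noiseIntensity (D : LQGData n m p) (K : Controller m p q) : Matrix (n ⊕ q) (n ⊕ q) ℝ :=
  Matrix.fromBlocks D.W 0 0 (K.BK * D.V * K.BKᵀ)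

/-- The set `𝒞_q` of internally stabilizing controllers of order `q`: all eigenvalues of the
closed-loop matrix have negative real part. -/
def stabilizing (D : LQGData n m p) : Set (Controller m p q) :=
  {K | ∀ μ ∈ spectrum ℂ ((D.closedLoop K).map (algebraMap ℝ ℂ)), μ.re < 0}

/-- Mean at time `t` of the closed-loop state started at `z₀`. -/
def stateMean (D : LQGData n m p) (z₀ : EuclideanSpace ℝ (n ⊕ q)) (K : Controller m p q) (t : ℝ) :
    EuclideanSpace ℝ (n ⊕ q) :=
  WithLp.toLp 2 (NormedSpace.exp (t • D.closedLoop K) *ᵥ WithLp.ofLp z₀)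

/-- Covariance at time `t` of the closed-loop state started at a deterministic point:
`∫₀ᵗ e^{A_cl (t - s)} [W, 0; 0, B_K V B_Kᵀ] e^{A_clᵀ (t - s)} ds`. -/
def stateCov (D : LQGData n m p) (K : Controller m p q) (t : ℝ) : Matrix (n ⊕ q) (n ⊕ q) ℝ :=
  Matrix.of fun i j => ∫ s in (0 : ℝ)..t,
    (NormedSpace.exp ((t - s) • D.closedLoop K) * D.noiseIntensity K *
      NormedSpace.exp ((t - s) • (D.closedLoop K)ᵀ)) i j

/-- Law at time `t` of the closed-loop state `(x(t), ξ(t))` started at `z₀`, i.e. of the Gaussian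
process that solves `d(x, ξ) = A_cl (x, ξ) dt + (dw, B_K dv)`. -/
def stateLaw (D : LQGData n m p) (z₀ : EuclideanSpace ℝ (n ⊕ q)) (K : Controller m p q) (t : ℝ) :
    Measure (EuclideanSpace ℝ (n ⊕ q)) :=
  multivariateGaussian (D.stateMean z₀ K t) (D.stateCov K t)

/-- The running cost `xᵀ Q x + uᵀ R u` with `u = C_K ξ`, at the joint state `z = (x, ξ)`. -/
def runningCost (D : LQGData n m p) (K : Controller m p q) (z : EuclideanSpace ℝ (n ⊕ q)) : ℝ :=
  let x : n → ℝ := fun i => z (Sum.inl i)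
  let u : m → ℝ := K.CK *ᵥ fun j => z (Sum.inr j)
  x ⬝ᵥ (D.Q *ᵥ x) + u ⬝ᵥ (D.R *ᵥ u)

/-- The expected average cost `(1/T) ∫₀ᵀ 𝔼[xᵀ Q x + uᵀ R u] dt` over the horizon `[0, T]`. -/
def averageCost (D : LQGData n m p) (z₀ : EuclideanSpace ℝ (n ⊕ q)) (K : Controller m p q)
    (T : ℝ) : ℝ :=
  1 / T * ∫ t in (0 : ℝ)..T, ∫ z, D.runningCost K z ∂(D.stateLaw z₀ K t)

/-- The LQG cost `J_q(K)`, the limit of the expected average cost as `T → ∞`. -/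
def cost (D : LQGData n m p) (z₀ : EuclideanSpace ℝ (n ⊕ q)) (K : Controller m p q) : ℝ :=
  limUnder atTop (D.averageCost z₀ K)

/-- The Hessian bilinear form of the LQG cost at `K`. -/
def hess (D : LQGData n m p) (z₀ : EuclideanSpace ℝ (n ⊕ q)) (K Δ Δ' : Controller m p q) : ℝ :=
  fderiv ℝ (fderiv ℝ (D.cost z₀)) K Δ Δ'

/-- The controller `[0, -K; L, A - B K - L C]` with the gains `K = R⁻¹ Bᵀ S`, `L = P Cᵀ V⁻¹`. -/
def riccatiController (D : LQGData n m p) (P S : Matrix n n ℝ) : Controller m p n :=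
  Controller.ofBlocks (-(D.R⁻¹ * D.Bᵀ * S)) (P * D.Cᵀ * D.V⁻¹)
    (D.A - D.B * (D.R⁻¹ * D.Bᵀ * S) - P * D.Cᵀ * D.V⁻¹ * D.C)

end LQGData

/-! ## Tangent space of the orbit and the restricted Hessian -/

/-- Tangent vectors at `x` of a subset `M` of a Euclidean space: velocities at time `0` of smooth
curves `(-1, 1) → M` through `x`. -/
def tangentVectors {E : Type} [NormedAddCommGroup E] [NormedSpace ℝ E] (M : Set E) (x : E) :
    Set E :=
  {v | ∃ γ : ℝ → E, ContDiffOn ℝ ∞ γ (Set.Ioo (-1) 1) ∧ (∀ t ∈ Set.Ioo (-1 : ℝ) 1, γ t ∈ M) ∧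
    γ 0 = x ∧ HasDerivAt γ v 0}

/-- The tangent space `𝒯𝒪_K` of the orbit of `K` at `K`. When the orbit is a submanifold, the
tangent vectors already form a linear subspace and the span adds nothing. -/
def orbitTangent {m p q : Type} [Fintype m] [Fintype p] [Fintype q] [DecidableEq q]
    (K : Controller m p q) : Submodule ℝ (Controller m p q) :=
  Submodule.span ℝ (tangentVectors K.orbit K)

namespace LQGData

variable {n m p q : Type} [Fintype n] [Fintype m] [Fintype p] [Fintype q]
  [DecidableEq n] [DecidableEq m] [DecidableEq p] [DecidableEq q]

/-- The values `Hess_K(Δ, Δ) / ‖Δ‖²` for nonzero `Δ ⟂ 𝒯𝒪_K`. -/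
def normalRayleigh (D : LQGData n m p) (z₀ : EuclideanSpace ℝ (n ⊕ q)) (K : Controller m p q) :
    Set ℝ :=
  {r | ∃ Δ ∈ (orbitTangent K)ᗮ, Δ ≠ 0 ∧ r = D.hess z₀ K Δ Δ / ‖Δ‖ ^ 2}

/-- The reciprocal condition number of the Hessian at `K` restricted to the normal space of the
orbit: the minimum of the Rayleigh quotient divided by its maximum. -/
def rcond (D : LQGData n m p) (z₀ : EuclideanSpace ℝ (n ⊕ q)) (K : Controller m p q) : ℝ :=
  sInf (D.normalRayleigh z₀ K) / sSup (D.normalRayleigh z₀ K)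

end LQGData

/-! ## The example -/

/-- The family of plants. -/
def examplePlant (ε : ℝ) : LQGData (Fin 2) (Fin 1) (Fin 1) where
  A := (3 / 2 : ℝ) • !![-1, 0; 0, -1 - ε]
  B := !![1; 1 + ε]
  C := !![1, 1]
  Q := !![4, 1; 1, 4]
  R := 1
  W := !![4, 1 + ε; 1 + ε, 4 * (1 + ε) ^ 2]
  V := 1

/-- Solution of the filter Riccati equation. -/
def exampleP (ε : ℝ) : Matrix (Fin 2) (Fin 2) ℝ := !![1, 0; 0, 1 + ε]

/-- Solution of the control Riccati equation. -/
def exampleS (ε : ℝ) : Matrix (Fin 2) (Fin 2) ℝ := !![1, 0; 0, 1 / (1 + ε)]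

/-- The optimal controller `K*`. -/
def exampleK (ε : ℝ) : Controller (Fin 1) (Fin 1) (Fin 2) :=
  (examplePlant ε).riccatiController (exampleP ε) (exampleS ε)

/-- The direction `Δ₀`. -/
def exampleΔ₀ : Controller (Fin 1) (Fin 1) (Fin 2) :=
  Controller.ofBlocks !![0, 0] !![0; 0] !![-1 / 2, 1 / 2; 1 / 2, -1 / 2]

/-- The direction `Δ₁`. -/
def exampleΔ₁ : Controller (Fin 1) (Fin 1) (Fin 2) :=
  Controller.ofBlocks !![-1 / 2, -1 / 2] !![1 / 2; 1 / 2] !![0, 0; 0, 0]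

theorem exampleP_riccati (ε : ℝ) (hε : 0 < ε) :
    (exampleP ε).PosDef ∧
      (examplePlant ε).A * exampleP ε + exampleP ε * (examplePlant ε).Aᵀ
        - exampleP ε * (examplePlant ε).Cᵀ * (examplePlant ε).V⁻¹ * (examplePlant ε).C * exampleP ε
        + (examplePlant ε).W = 0 := by
  constructor
  · have h : exampleP ε = Matrix.diagonal ![1, 1 + ε] := by
      ext i j; fin_cases i <;> fin_cases j <;> simp [exampleP]
    rw [h, Matrix.posDef_diagonal_iff]
    intro i; fin_cases i <;> simp <;> linarith
  · ext i j
    fin_cases i <;> fin_cases j <;>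
      simp [examplePlant, exampleP, Matrix.vecMul, Matrix.mul_apply, dotProduct,
        Matrix.vecHead, Matrix.vecTail] <;> ring

theorem exampleS_riccati (ε : ℝ) (hε : 0 < ε) :
    (exampleS ε).PosDef ∧
      (examplePlant ε).Aᵀ * exampleS ε + exampleS ε * (examplePlant ε).A
        - exampleS ε * (examplePlant ε).B * (examplePlant ε).R⁻¹ * (examplePlant ε).Bᵀ * exampleS ε
        + (examplePlant ε).Q = 0 := by
  have h1 : (1 + ε) ≠ 0 := by positivity
  constructor
  · have h : exampleS ε = Matrix.diagonal ![1, 1 / (1 + ε)] := by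
      ext i j; fin_cases i <;> fin_cases j <;> simp [exampleS]
    rw [h, Matrix.posDef_diagonal_iff]
    intro i; fin_cases i <;> simp <;> linarith
  · ext i j
    fin_cases i <;> fin_cases j <;>
      simp [examplePlant, exampleS, Matrix.vecMul, Matrix.mul_apply, dotProduct,
        Matrix.vecHead, Matrix.vecTail] <;> field_simp <;> ring

theorem exampleK_eq (ε : ℝ) (hε : 0 < ε) :
    exampleK ε = Controller.ofBlocks !![-1, -1] !![1; 1 + ε]
      !![-7 / 2, -2; -2 * (1 + ε), -7 / 2 * (1 + ε)] := by
  have h1 : (1 + ε) ≠ 0 := by positivity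
  unfold exampleK LQGData.riccatiController
  congr 1
  all_goals
    ext i j
    fin_cases i <;> fin_cases j <;>
      simp [examplePlant, exampleP, exampleS, Matrix.vecMul, Matrix.mul_apply, dotProduct,
        Matrix.vecHead, Matrix.vecTail] <;>
      field_simp <;> ring

end

set_option linter.unusedSectionVars false
set_option linter.unusedSimpArgs false
set_option linter.unnecessarySeqFocus false

/-! ## Exponentially stable real matrices -/

section StableMatrices

open scoped Matrix.Norms.Operator

variable {ι : Type*} [Fintype ι]

/-! For a stable closed loop `M` with noise intensity `N` and cost weight `S`, the mean and the
transient part of the covariance decay, so the averaged cost tends to `tr (S X)`, where `M X + X Mᵀ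
+ N = 0`. The operator `X ↦ M X + X Mᵀ` is invertible when `M` is stable, so `X`, and with it the
cost, depends smoothly on the controller (`tendsto_averageCost`, `contDiffAt_cost`). Stability near
`K*` comes from one Lyapunov matrix that still works after small perturbations.

Along `K + tΔ`, pairing the equation of the covariance `X(t)` with the solution `Y` of the dual
equation `Mᵀ Y + Y M + S = 0` writes the cost as a quadratic polynomial in `t` plus `t` times an
expression in `X(t)`. Hence two derivatives of the cost need only `X`, `Y` and the first derivative
`X₁` of the covariance (`cost_line_derivs`). In the example these are explicit rational functions of
`ε`; the gradient at `K*` vanishes and the two Hessian values are exact rational functions.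

The fourth order has a structural reason. At `ε = 0` the vector `(1, -1)` is a mode of the
controller that is neither excited by `y` nor seen by `u`, and `Δ₀` perturbs `A_K` only through it.
For small `ε` each coupling has size `ε`, so the transfer function of the controller moves by order
`ε²` and the cost, being stationary, by order `ε⁴`. The proof reads this off the exact value.

The cost is invariant under similarity, so its gradient vanishes along the whole orbit of `K*` and
tangent vectors lie in the kernel of the Hessian (`hess_orbitTangent_left`). A direction and its
normal component therefore have the same Hessian value, and only the norm in the Rayleigh quotient
changes. Controllability places the tangent space inside the range of the differential of the group
action (`tangentVectors_orbit_subset`); subtracting an explicit vector of size `ε` makes `Δ₀`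
orthogonal to that range, so its projection is `O(ε)`. For `Δ₁` no projection need be computed:
dropping it only lowers a positive quotient. -/

theorem Matrix.PosDef.dotProduct_mulVec_pos_real {A : Matrix ι ι ℝ} (hA : A.PosDef) {v : ι → ℝ}
    (hv : v ≠ 0) : 0 < v ⬝ᵥ A *ᵥ v := by
  simpa using hA.dotProduct_mulVec_pos hv

/-- Positive definiteness is stable under small symmetric perturbations. -/
theorem Matrix.PosDef.eventually_posDef {X : Type*} [TopologicalSpace X] {f : X → Matrix ι ι ℝ}
    {x₀ : X} (hf : Continuous f) (hsymm : ∀ x, (f x).IsHermitian) (h₀ : (f x₀).PosDef) :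
    ∀ᶠ x in 𝓝 x₀, (f x).PosDef := by
  -- Compactness of the unit sphere makes one neighbourhood of `x₀` serve all unit vectors;
  -- homogeneity of the quadratic form does the rest.
  have hsphere : ∀ᶠ x in 𝓝 x₀, ∀ v ∈ Metric.sphere (0 : ι → ℝ) 1, 0 < v ⬝ᵥ f x *ᵥ v := by
    refine (isCompact_sphere (0 : ι → ℝ) 1).eventually_forall_of_forall_eventually fun v hv => ?_
    have hcont : Continuous fun z : X × (ι → ℝ) => z.2 ⬝ᵥ f z.1 *ᵥ z.2 :=
      continuous_snd.dotProduct ((hf.comp continuous_fst).matrix_mulVec continuous_snd)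
    refine hcont.continuousAt.eventually (lt_mem_nhds ?_)
    exact h₀.dotProduct_mulVec_pos_real (Metric.ne_of_mem_sphere hv one_ne_zero)
  filter_upwards [hsphere] with x hx
  refine .of_dotProduct_mulVec_pos (hsymm x) fun v hv => ?_
  have hn : 0 < ‖v‖ := norm_pos_iff.2 hv
  have hu := hx (‖v‖⁻¹ • v) (by simp [norm_smul, hn.ne'])
  rw [Matrix.mulVec_smul, smul_dotProduct, dotProduct_smul, smul_eq_mul, smul_eq_mul] at hu
  rw [star_trivial]
  exact pos_of_mul_pos_right (pos_of_mul_pos_right hu (by positivity)) (by positivity)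

/-- A positive definite matrix dominates a small multiple of any symmetric matrix. -/
theorem Matrix.PosDef.exists_pos_sub_smul {A B : Matrix ι ι ℝ} (hA : A.PosDef)
    (hB : B.IsHermitian) : ∃ c : ℝ, 0 < c ∧ (A - c • B).PosDef := by
  have h : ∀ᶠ c in 𝓝 (0 : ℝ), (A - c • B).PosDef := by
    refine Matrix.PosDef.eventually_posDef (f := fun c : ℝ => A - c • B) (by fun_prop)
      (fun c => hA.1.sub (hB.smul (by simp [IsSelfAdjoint]))) (by simpa using hA)
  obtain ⟨c, hc, hpos⟩ := ((h.filter_mono nhdsWithin_le_nhds).and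
    (self_mem_nhdsWithin (s := Set.Ioi (0 : ℝ)))).exists
  exact ⟨c, hpos, hc⟩

theorem HasDerivAt.linearMap_comp {E F : Type*} [NormedAddCommGroup E] [NormedSpace ℝ E]
    [FiniteDimensional ℝ E] [NormedAddCommGroup F] [NormedSpace ℝ F] (φ : E →ₗ[ℝ] F) {f : ℝ → E}
    {f' : E} {t : ℝ} (hf : HasDerivAt f f' t) : HasDerivAt (fun s => φ (f s)) (φ f') t :=
  (LinearMap.toContinuousLinearMap φ).hasFDerivAt.comp_hasDerivAt t hf

/-- The quadratic form `A ↦ vᵀ A v` as a linear functional of the matrix. -/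
def Matrix.quadFormLinear (v : ι → ℝ) : Matrix ι ι ℝ →ₗ[ℝ] ℝ where
  toFun A := v ⬝ᵥ A *ᵥ v
  map_add' A B := by rw [Matrix.add_mulVec, dotProduct_add]
  map_smul' c A := by rw [Matrix.smul_mulVec, dotProduct_smul]; rfl

theorem Matrix.dotProduct_transpose_mul_mul_mulVec (E S : Matrix ι ι ℝ) (v : ι → ℝ) :
    v ⬝ᵥ (Eᵀ * S * E) *ᵥ v = (E *ᵥ v) ⬝ᵥ S *ᵥ (E *ᵥ v) := by
  rw [← Matrix.mulVec_mulVec, ← Matrix.mulVec_mulVec, Matrix.dotProduct_mulVec,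
    Matrix.vecMul_transpose]

variable [DecidableEq ι]

theorem Matrix.exp_smul_transpose (M : Matrix ι ι ℝ) (t : ℝ) :
    NormedSpace.exp (t • Mᵀ) = (NormedSpace.exp (t • M))ᵀ := by
  rw [← Matrix.transpose_smul, Matrix.exp_transpose]

/-- A square matrix is exponentially stable if its flow tends to zero. -/
def Matrix.IsExpStable (M : Matrix ι ι ℝ) : Prop :=
  Tendsto (fun t : ℝ => NormedSpace.exp (t • M)) atTop (𝓝 0)

theorem Matrix.hasDerivAt_exp_smul (M : Matrix ι ι ℝ) (t : ℝ) :
    HasDerivAt (fun s : ℝ => NormedSpace.exp (s • M)) (M * NormedSpace.exp (t • M)) t :=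
  hasDerivAt_exp_smul_const' M t

theorem Matrix.hasDerivAt_exp_smul' (M : Matrix ι ι ℝ) (t : ℝ) :
    HasDerivAt (fun s : ℝ => NormedSpace.exp (s • M)) (NormedSpace.exp (t • M) * M) t :=
  hasDerivAt_exp_smul_const M t

/-- The derivative of `t ↦ e^{tA} X e^{tB}`. -/
theorem Matrix.hasDerivAt_exp_mul_exp (A B X : Matrix ι ι ℝ) (t : ℝ) :
    HasDerivAt (fun s : ℝ => NormedSpace.exp (s • A) * X * NormedSpace.exp (s • B))
      (NormedSpace.exp (t • A) * (A * X + X * B) * NormedSpace.exp (t • B)) t := by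
  have h := ((A.hasDerivAt_exp_smul' t).mul_const X).mul (B.hasDerivAt_exp_smul t)
  have hsum : NormedSpace.exp (t • A) * (A * X + X * B) * NormedSpace.exp (t • B) =
      NormedSpace.exp (t • A) * A * X * NormedSpace.exp (t • B) +
        NormedSpace.exp (t • A) * X * (B * NormedSpace.exp (t • B)) := by
    noncomm_ring
  rwa [hsum]

theorem Matrix.continuous_exp_smul (M : Matrix ι ι ℝ) :
    Continuous fun t : ℝ => NormedSpace.exp (t • M) :=
  continuous_iff_continuousAt.2 fun t => (M.hasDerivAt_exp_smul t).continuousAt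

/-- Lyapunov's criterion. -/
theorem Matrix.isExpStable_of_lyapunov {M P : Matrix ι ι ℝ} (hP : P.PosDef)
    (hG : (-(Mᵀ * P + P * M)).PosDef) : M.IsExpStable := by
  -- The constant `c` is a decay rate for the energy `P`; below, `d` is a lower bound `P ≥ d • 1`
  -- that turns energy decay into decay of entries.
  obtain ⟨c, hc, hGc⟩ := hG.exists_pos_sub_smul hP.1
  obtain ⟨d, hd, hPd⟩ := hP.exists_pos_sub_smul Matrix.isHermitian_one
  have hanti (v : ι → ℝ) : Antitone fun t : ℝ => Real.exp (c * t) *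
      (v ⬝ᵥ (NormedSpace.exp (t • Mᵀ) * P * NormedSpace.exp (t • M)) *ᵥ v) := by
    have hder (t : ℝ) := ((hasDerivAt_id t).const_mul c).exp.mul
      ((Matrix.hasDerivAt_exp_mul_exp Mᵀ M P t).linearMap_comp (Matrix.quadFormLinear v))
    refine antitone_of_hasDerivAt_nonpos (fun t => hder t) fun t => ?_
    have hpos := hGc.posSemidef.dotProduct_mulVec_nonneg (NormedSpace.exp (t • M) *ᵥ v)
    rw [star_trivial, ← Matrix.dotProduct_transpose_mul_mul_mulVec, ← Matrix.exp_smul_transpose,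
      Matrix.mul_sub, Matrix.sub_mul, Matrix.sub_mulVec, dotProduct_sub, Matrix.mul_neg,
      Matrix.neg_mul, Matrix.neg_mulVec, dotProduct_neg, Matrix.mul_smul, Matrix.smul_mul,
      Matrix.smul_mulVec, dotProduct_smul, smul_eq_mul] at hpos
    have hexp := Real.exp_pos (c * t)
    simp only [Matrix.quadFormLinear, LinearMap.coe_mk, AddHom.coe_mk, id_eq, mul_one]
    rw [Pi.zero_apply]
    nlinarith [mul_nonneg hexp.le hpos]
  -- With `v` the `j`-th basis vector, the energy at time `0` is `P j j` and at time `t` it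
  -- dominates `d` times the squared `j`-th column of the flow.
  have hbound (i j : ι) (t : ℝ) (ht : 0 ≤ t) :
      NormedSpace.exp (t • M) i j ^ 2 ≤ P j j / d * Real.exp (-(c * t)) := by
    set v : ι → ℝ := Pi.single j 1 with hv
    have h1 := hanti v ht
    have h2 := hPd.posSemidef.dotProduct_mulVec_nonneg (NormedSpace.exp (t • M) *ᵥ v)
    rw [star_trivial, Matrix.sub_mulVec, Matrix.smul_mulVec, Matrix.one_mulVec, dotProduct_sub,
      dotProduct_smul, smul_eq_mul, ← Matrix.dotProduct_transpose_mul_mul_mulVec,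
      ← Matrix.exp_smul_transpose] at h2
    have h3 : NormedSpace.exp (t • M) i j ^ 2 ≤
        (NormedSpace.exp (t • M) *ᵥ v) ⬝ᵥ (NormedSpace.exp (t • M) *ᵥ v) := by
      have h4 := Finset.single_le_sum (f := fun k => (NormedSpace.exp (t • M) *ᵥ v) k *
        (NormedSpace.exp (t • M) *ᵥ v) k) (fun k _ => mul_self_nonneg _) (Finset.mem_univ i)
      rw [hv, Matrix.mulVec_single_one] at h4 ⊢
      simpa [sq, dotProduct] using h4
    have h5 : v ⬝ᵥ P *ᵥ v = P j j := by simp [hv]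
    simp only [zero_smul, NormedSpace.exp_zero, mul_zero, Real.exp_zero, one_mul, mul_one,
      h5] at h1
    rw [Real.exp_neg, div_mul_eq_mul_div, le_div_iff₀ hd, ← div_eq_mul_inv,
      le_div_iff₀ (Real.exp_pos _)]
    nlinarith [mul_le_mul_of_nonneg_right h3 hd.le, Real.exp_pos (c * t)]
  refine tendsto_pi_nhds.2 fun i => tendsto_pi_nhds.2 fun j => ?_
  have hlim : Tendsto (fun t => P j j / d * Real.exp (-(c * t))) atTop (𝓝 0) := by
    have h := (Real.tendsto_exp_neg_atTop_nhds_zero.comp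
      (tendsto_id.const_mul_atTop hc)).const_mul (P j j / d)
    simpa using h
  have hsq : Tendsto (fun t : ℝ => NormedSpace.exp (t • M) i j ^ 2) atTop (𝓝 0) :=
    squeeze_zero' (Eventually.of_forall fun t => sq_nonneg _)
      ((eventually_ge_atTop 0).mono fun t ht => hbound i j t ht) hlim
  have habs := hsq.sqrt
  simp only [Real.sqrt_sq_eq_abs, Real.sqrt_zero] at habs
  exact (tendsto_zero_iff_abs_tendsto_zero _).2 habs

/-- Lyapunov's criterion, spectral form. -/
theorem Matrix.re_neg_of_mem_spectrum_of_lyapunov {M P : Matrix ι ι ℝ} (hP : P.PosDef)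
    (hG : (-(Mᵀ * P + P * M)).PosDef) {μ : ℂ}
    (hμ : μ ∈ spectrum ℂ (M.map (algebraMap ℝ ℂ))) : μ.re < 0 := by
  obtain ⟨v, hv⟩ := (Module.End.hasEigenvalue_iff_mem_spectrum.2
    ((Matrix.spectrum_toLin' (M.map (algebraMap ℝ ℂ))).symm ▸ hμ)).exists_hasEigenvector
  have hMv : M.map (algebraMap ℝ ℂ) *ᵥ v = μ • v := by
    simpa [Matrix.toLin'_apply] using hv.apply_eq_smul
  set a : ι → ℝ := fun i => (v i).re with ha
  set b : ι → ℝ := fun i => (v i).im with hb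
  have hMa : M *ᵥ a = μ.re • a - μ.im • b := by
    ext i
    have h := congrArg Complex.re (congrFun hMv i)
    simpa [Matrix.mulVec, dotProduct, ha, hb, Complex.mul_re] using h
  have hMb : M *ᵥ b = μ.im • a + μ.re • b := by
    ext i
    have h := congrArg Complex.im (congrFun hMv i)
    simp only [Matrix.mulVec, dotProduct, ha, hb, Matrix.map_apply, Complex.im_sum, Pi.smul_apply,
      Pi.add_apply, smul_eq_mul, Complex.mul_im] at h ⊢
    simpa [add_comm] using h
  have hsymm (x y : ι → ℝ) : x ⬝ᵥ P *ᵥ y = y ⬝ᵥ P *ᵥ x := by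
    have hPt : Pᵀ = P := by simpa [Matrix.IsHermitian] using hP.1
    rw [Matrix.dotProduct_mulVec, ← Matrix.mulVec_transpose, hPt, dotProduct_comm]
  have hquad (x : ι → ℝ) : x ⬝ᵥ (-(Mᵀ * P + P * M)) *ᵥ x = -(2 * ((M *ᵥ x) ⬝ᵥ P *ᵥ x)) := by
    rw [Matrix.neg_mulVec, Matrix.add_mulVec, dotProduct_neg, dotProduct_add,
      ← Matrix.mulVec_mulVec, ← Matrix.mulVec_mulVec, hsymm x (M *ᵥ x), Matrix.dotProduct_mulVec,
      Matrix.vecMul_transpose]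
    ring
  -- Adding the forms at the real and imaginary parts of the eigenvector cancels `μ.im`, since `P`
  -- is symmetric. The sign of `μ.re` then follows from the two positivities.
  have hsum : a ⬝ᵥ (-(Mᵀ * P + P * M)) *ᵥ a + b ⬝ᵥ (-(Mᵀ * P + P * M)) *ᵥ b =
      -(2 * μ.re) * (a ⬝ᵥ P *ᵥ a + b ⬝ᵥ P *ᵥ b) := by
    rw [hquad, hquad, hMa, hMb]
    simp only [sub_dotProduct, add_dotProduct, smul_dotProduct, smul_eq_mul, hsymm b a]
    ring
  have hab : a ≠ 0 ∨ b ≠ 0 := by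
    by_contra! h
    exact hv.2 (funext fun i => Complex.ext (congrFun h.1 i) (congrFun h.2 i))
  have hnonneg {S : Matrix ι ι ℝ} (hS : S.PosDef) (x : ι → ℝ) : 0 ≤ x ⬝ᵥ S *ᵥ x := by
    simpa using hS.posSemidef.dotProduct_mulVec_nonneg x
  have hpos {S : Matrix ι ι ℝ} (hS : S.PosDef) : 0 < a ⬝ᵥ S *ᵥ a + b ⬝ᵥ S *ᵥ b := by
    rcases hab with h | h
    · exact add_pos_of_pos_of_nonneg (hS.dotProduct_mulVec_pos_real h) (hnonneg hS b)
    · exact add_pos_of_nonneg_of_pos (hnonneg hS a) (hS.dotProduct_mulVec_pos_real h)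
  nlinarith [hpos hG, hpos hP]

theorem Matrix.IsExpStable.transpose {M : Matrix ι ι ℝ} (hM : M.IsExpStable) :
    Mᵀ.IsExpStable := by
  have h := (continuous_id.matrix_transpose.tendsto (0 : Matrix ι ι ℝ)).comp hM
  simpa [Matrix.IsExpStable, Function.comp_def, Matrix.exp_smul_transpose] using h

theorem Matrix.IsExpStable.conj {M U : Matrix ι ι ℝ} (hM : M.IsExpStable) (hU : IsUnit U) :
    (U * M * U⁻¹).IsExpStable := by
  have h := (Tendsto.const_mul U hM).mul_const U⁻¹
  simp only [mul_zero, zero_mul] at h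
  refine h.congr fun t => ?_
  rw [← Matrix.exp_conj U _ hU, Matrix.mul_smul, Matrix.smul_mul]

theorem Matrix.IsExpStable.tendsto_mul_mul {A B : Matrix ι ι ℝ} (hA : A.IsExpStable)
    (hB : B.IsExpStable) (X : Matrix ι ι ℝ) :
    Tendsto (fun t : ℝ => NormedSpace.exp (t • A) * X * NormedSpace.exp (t • B)) atTop (𝓝 0) := by
  simpa using (Tendsto.mul_const X hA).mul hB

/-- The Sylvester equation of two exponentially stable matrices has at most one solution. -/
theorem Matrix.IsExpStable.eq_zero_of_sylvester {A B X : Matrix ι ι ℝ} (hA : A.IsExpStable)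
    (hB : B.IsExpStable) (hX : A * X + X * B = 0) : X = 0 := by
  -- The derivative of `e^{tA} X e^{tB}` contains the factor `A X + X B = 0`; a constant that tends
  -- to `0` is `0`.
  have hconst (t : ℝ) : NormedSpace.exp (t • A) * X * NormedSpace.exp (t • B) = X := by
    have h := is_const_of_deriv_eq_zero
      (f := fun s : ℝ => NormedSpace.exp (s • A) * X * NormedSpace.exp (s • B))
      (fun s => (Matrix.hasDerivAt_exp_mul_exp A B X s).differentiableAt)
      (fun s => by rw [(Matrix.hasDerivAt_exp_mul_exp A B X s).deriv, hX, mul_zero, zero_mul]) t 0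
    simpa using h
  refine (tendsto_nhds_unique (hA.tendsto_mul_mul hB X) ?_).symm
  simp only [hconst]
  exact tendsto_const_nhds

/-- The Sylvester equation of two exponentially stable matrices is solvable. -/
theorem Matrix.IsExpStable.exists_sylvester {A B : Matrix ι ι ℝ} (hA : A.IsExpStable)
    (hB : B.IsExpStable) (N : Matrix ι ι ℝ) : ∃ X, A * X + X * B + N = 0 := by
  let φ : Matrix ι ι ℝ →ₗ[ℝ] Matrix ι ι ℝ := LinearMap.mulLeft ℝ A + LinearMap.mulRight ℝ B
  have hφ : Function.Injective φ := (injective_iff_map_eq_zero φ).2 fun X hX =>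
    hA.eq_zero_of_sylvester hB (by simpa [φ] using hX)
  obtain ⟨X, hX⟩ := LinearMap.injective_iff_surjective.1 hφ (-N)
  exact ⟨X, by simpa [φ] using eq_neg_iff_add_eq_zero.1 hX⟩

end StableMatrices

/-! ## The LQG cost through Lyapunov equations -/

section GaussianMoments

variable {ι : Type*} [Fintype ι] [DecidableEq ι]

theorem ProbabilityTheory.memLp_eval_multivariateGaussian (μ : EuclideanSpace ℝ ι)
    (S : Matrix ι ι ℝ) (i : ι) : MemLp (fun z => z i) 2 (multivariateGaussian μ S) :=
  (EuclideanSpace.proj (𝕜 := ℝ) i).comp_memLp' IsGaussian.memLp_two_id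

theorem ProbabilityTheory.integral_eval_multivariateGaussian (μ : EuclideanSpace ℝ ι)
    (S : Matrix ι ι ℝ) (i : ι) : ∫ z, z i ∂(multivariateGaussian μ S) = μ i := by
  have h := (EuclideanSpace.proj (𝕜 := ℝ) i).integral_comp_id_comm
    (μ := multivariateGaussian μ S) IsGaussian.integrable_id
  simpa using h

/-- Expectation of a quadratic form of a Gaussian vector. -/
theorem ProbabilityTheory.integral_quadForm_multivariateGaussian (μ : EuclideanSpace ℝ ι)
    {S : Matrix ι ι ℝ} (hS : S.PosSemidef) (Q : Matrix ι ι ℝ) :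
    ∫ z, WithLp.ofLp z ⬝ᵥ Q *ᵥ WithLp.ofLp z ∂(multivariateGaussian μ S) =
      WithLp.ofLp μ ⬝ᵥ Q *ᵥ WithLp.ofLp μ + (Q * S).trace := by
  have hmoment (i j : ι) : ∫ z, z i * z j ∂(multivariateGaussian μ S) = S i j + μ i * μ j := by
    have h := covariance_eval_multivariateGaussian (μ := μ) hS i j
    rw [covariance_eq_sub (memLp_eval_multivariateGaussian μ S i)
      (memLp_eval_multivariateGaussian μ S j), integral_eval_multivariateGaussian,
      integral_eval_multivariateGaussian] at h
    simp only [Pi.mul_apply] at h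
    linarith
  have hint (i j : ι) : Integrable (fun z => z i * z j) (multivariateGaussian μ S) :=
    (memLp_eval_multivariateGaussian μ S i).integrable_mul (memLp_eval_multivariateGaussian μ S j)
  have hexpand (z : ι → ℝ) : z ⬝ᵥ Q *ᵥ z = ∑ i, ∑ j, Q i j * (z j * z i) := by
    simp only [Matrix.mulVec, dotProduct, Finset.mul_sum]
    exact Finset.sum_congr rfl fun i _ => Finset.sum_congr rfl fun j _ => by ring
  have hsum (c : ι → ι → ℝ) : ∫ z : EuclideanSpace ℝ ι, ∑ i, ∑ j, c i j * (z j * z i)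
      ∂(multivariateGaussian μ S) = ∑ i, ∑ j, c i j * (S j i + μ j * μ i) := by
    refine (integral_finsetSum _ fun i _ => integrable_finsetSum _ fun j _ =>
      (hint j i).const_mul (c i j)).trans (Finset.sum_congr rfl fun i _ => ?_)
    refine (integral_finsetSum _ fun j _ => (hint j i).const_mul (c i j)).trans
      (Finset.sum_congr rfl fun j _ => ?_)
    rw [integral_const_mul, hmoment]
  simp only [hexpand]
  refine (hsum Q).trans ?_
  simp only [Matrix.trace, Matrix.diag, Matrix.mul_apply, mul_add, Finset.sum_add_distrib]
  ring

/-- The covariance is an entrywise integral; this reduces its positivity to that of a scalar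
integrand. -/
theorem Matrix.dotProduct_integral_mulVec {g : ℝ → Matrix ι ι ℝ} (hg : Continuous g) (a b : ℝ)
    (z : ι → ℝ) : z ⬝ᵥ (Matrix.of fun i j => ∫ s in a..b, g s i j) *ᵥ z =
      ∫ s in a..b, z ⬝ᵥ g s *ᵥ z := by
  have hint (i j : ι) : IntervalIntegrable (fun s => g s i j * z j) volume a b :=
    ((hg.matrix_elem i j).mul continuous_const).intervalIntegrable a b
  have hcont (i : ι) : Continuous fun s => z i * ∑ j, g s i j * z j :=
    continuous_const.mul (continuous_finsetSum _ fun j _ => (hg.matrix_elem i j).mul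
      continuous_const)
  refine .symm <| (intervalIntegral.integral_finsetSum
    fun i _ => (hcont i).intervalIntegrable a b).trans (Finset.sum_congr rfl fun i _ => ?_)
  refine (intervalIntegral.integral_const_mul _ _).trans (congrArg (z i * ·) ?_)
  refine (intervalIntegral.integral_finsetSum fun j _ => hint i j).trans
    (Finset.sum_congr rfl fun j _ => ?_)
  exact intervalIntegral.integral_mul_const _ _

end GaussianMoments

namespace LQGData

open scoped Matrix.Norms.Operator

/-- Cyclicity of the trace, used to move the flow from the covariance onto the cost weight. -/
theorem _root_.Matrix.trace_mul_conj_comm {ι : Type*} [Fintype ι] (S E X F : Matrix ι ι ℝ) :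
    (S * (E * X * F)).trace = (X * (F * S * E)).trace := by
  rw [← mul_assoc, ← mul_assoc, mul_assoc (S * E), Matrix.trace_mul_comm]
  simp only [mul_assoc]

variable {n m p q : Type} [Fintype n] [Fintype m] [Fintype p] [Fintype q]
  [DecidableEq n] [DecidableEq m] [DecidableEq p] [DecidableEq q]

/-- The weight `[Q, 0; 0, C_Kᵀ R C_K]` of the running cost as a quadratic form in `(x, ξ)`. -/
def costWeight (D : LQGData n m p) (K : Controller m p q) : Matrix (n ⊕ q) (n ⊕ q) ℝ :=
  Matrix.fromBlocks D.Q 0 0 (K.CKᵀ * D.R * K.CK)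

theorem runningCost_eq (D : LQGData n m p) (K : Controller m p q) (z : EuclideanSpace ℝ (n ⊕ q)) :
    D.runningCost K z = WithLp.ofLp z ⬝ᵥ D.costWeight K *ᵥ WithLp.ofLp z := by
  have hz : WithLp.ofLp z = Sum.elim (fun i => z (Sum.inl i)) (fun i => z (Sum.inr i)) := by
    ext i; cases i <;> rfl
  rw [hz, costWeight, Matrix.fromBlocks_mulVec, sumElim_dotProduct_sumElim]
  simp only [runningCost, Matrix.zero_mulVec, add_zero, zero_add, Sum.elim_comp_inl,
    Sum.elim_comp_inr, ← Matrix.mulVec_mulVec]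
  rw [Matrix.dotProduct_mulVec _ K.CKᵀ, Matrix.vecMul_transpose]

/-- The covariance solves the differential Lyapunov equation. -/
theorem stateCov_eq (D : LQGData n m p) (K : Controller m p q) {X : Matrix (n ⊕ q) (n ⊕ q) ℝ}
    (hX : D.closedLoop K * X + X * (D.closedLoop K)ᵀ + D.noiseIntensity K = 0) (t : ℝ) :
    D.stateCov K t = X - NormedSpace.exp (t • D.closedLoop K) * X *
      NormedSpace.exp (t • (D.closedLoop K)ᵀ) := by
  set M := D.closedLoop K
  set N := D.noiseIntensity K
  ext i j
  have hN : N = -(M * X + X * Mᵀ) := (neg_eq_of_add_eq_zero_right hX).symm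
  -- Since `N = -(M X + X Mᵀ)` and the time variable is `t - s`, the two signs cancel and the
  -- integrand is an exact derivative.
  have hder (s : ℝ) : HasDerivAt (fun s => (NormedSpace.exp ((t - s) • M) * X *
      NormedSpace.exp ((t - s) • Mᵀ)) i j) ((NormedSpace.exp ((t - s) • M) * N *
      NormedSpace.exp ((t - s) • Mᵀ)) i j) s := by
    have h := ((Matrix.hasDerivAt_exp_mul_exp M Mᵀ X (t - s)).scomp s
      ((hasDerivAt_id s).const_sub t)).linearMap_comp (Matrix.entryLinearMap ℝ ℝ i j)
    rw [hN, mul_neg, neg_mul]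
    simpa using h
  have hcont : Continuous fun s : ℝ => (NormedSpace.exp ((t - s) • M) * N *
      NormedSpace.exp ((t - s) • Mᵀ)) i j := by
    have h1 : Continuous fun s : ℝ => NormedSpace.exp ((t - s) • M) * N *
        NormedSpace.exp ((t - s) • Mᵀ) :=
      ((M.continuous_exp_smul.comp (continuous_sub_left t)).mul continuous_const).mul
        (Mᵀ.continuous_exp_smul.comp (continuous_sub_left t))
    exact h1.matrix_elem i j
  have h := intervalIntegral.integral_eq_sub_of_hasDerivAt (a := 0) (b := t)
    (fun s _ => hder s) (hcont.intervalIntegrable 0 t)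
  simpa [stateCov] using h

theorem noiseIntensity_posSemidef {D : LQGData n m p} (hW : D.W.PosSemidef) (hV : D.V.PosSemidef)
    (K : Controller m p q) : (D.noiseIntensity K).PosSemidef := by
  have hBV : (K.BK * D.V * K.BKᵀ).PosSemidef := by
    simpa using hV.mul_mul_conjTranspose_same K.BK
  refine .of_dotProduct_mulVec_nonneg ?_ fun z => ?_
  · exact Matrix.IsHermitian.fromBlocks hW.1 (by simp) hBV.1
  · obtain ⟨a, b, rfl⟩ : ∃ a b, z = Sum.elim a b := ⟨_, _, (Sum.elim_comp_inl_inr z).symm⟩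
    rw [star_trivial, noiseIntensity, Matrix.fromBlocks_mulVec, sumElim_dotProduct_sumElim]
    have h1 := hW.dotProduct_mulVec_nonneg a
    have h2 := hBV.dotProduct_mulVec_nonneg b
    simp only [star_trivial] at h1 h2
    simpa using add_nonneg h1 h2

/-- The second moments of `multivariateGaussian` are read off its matrix parameter only when that
parameter is positive semidefinite. -/
theorem stateCov_posSemidef {D : LQGData n m p} (hW : D.W.PosSemidef) (hV : D.V.PosSemidef)
    (K : Controller m p q) {t : ℝ} (ht : 0 ≤ t) : (D.stateCov K t).PosSemidef := by
  set M := D.closedLoop K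
  have hN := noiseIntensity_posSemidef hW hV K
  have hpsd (s : ℝ) : (NormedSpace.exp ((t - s) • M) * D.noiseIntensity K *
      NormedSpace.exp ((t - s) • Mᵀ)).PosSemidef := by
    rw [Matrix.exp_smul_transpose]
    simpa using hN.mul_mul_conjTranspose_same (NormedSpace.exp ((t - s) • M))
  have hcont : Continuous fun s : ℝ => NormedSpace.exp ((t - s) • M) * D.noiseIntensity K *
      NormedSpace.exp ((t - s) • Mᵀ) :=
    ((M.continuous_exp_smul.comp (continuous_sub_left t)).mul continuous_const).mul
      (Mᵀ.continuous_exp_smul.comp (continuous_sub_left t))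
  refine .of_dotProduct_mulVec_nonneg ?_ fun z => ?_
  · ext i j
    simp only [Matrix.conjTranspose_apply, star_trivial, stateCov, Matrix.of_apply]
    exact intervalIntegral.integral_congr fun s _ => by simpa using (hpsd s).1.apply i j
  · rw [star_trivial, stateCov, Matrix.dotProduct_integral_mulVec hcont]
    exact intervalIntegral.integral_nonneg ht fun s _ => by
      simpa using (hpsd s).dotProduct_mulVec_nonneg z

/-- The expected average cost converges to `tr (Q̂ X)`, where `X` is the stationary covariance. -/
theorem tendsto_averageCost {D : LQGData n m p} (hW : D.W.PosSemidef) (hV : D.V.PosSemidef)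
    (z₀ : EuclideanSpace ℝ (n ⊕ q)) {K : Controller m p q} (hK : (D.closedLoop K).IsExpStable)
    {X : Matrix (n ⊕ q) (n ⊕ q) ℝ}
    (hX : D.closedLoop K * X + X * (D.closedLoop K)ᵀ + D.noiseIntensity K = 0) :
    Tendsto (D.averageCost z₀ K) atTop (𝓝 (D.costWeight K * X).trace) := by
  obtain ⟨Y, hY⟩ := hK.transpose.exists_sylvester hK (D.costWeight K)
  set M := D.closedLoop K with hM
  set S := D.costWeight K with hS
  have hSY : S = -(Mᵀ * Y + Y * M) := (neg_eq_of_add_eq_zero_right hY).symm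
  set z : n ⊕ q → ℝ := WithLp.ofLp z₀ with hz
  -- The functional `ψ` collects the two transients: the quadratic term of the initial mean and the
  -- deficit of the covariance from `X`. The expected cost at time `t` is `f t`, and the dual
  -- solution `Y` provides its antiderivative `F`.
  let ψ : Matrix (n ⊕ q) (n ⊕ q) ℝ →ₗ[ℝ] ℝ := Matrix.quadFormLinear z -
    (Matrix.traceLinearMap (n ⊕ q) ℝ ℝ).comp (LinearMap.mulLeft ℝ X)
  have hψ (A) : ψ A = z ⬝ᵥ A *ᵥ z - (X * A).trace := rfl
  let F : ℝ → ℝ := fun t => (S * X).trace * t -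
    ψ (NormedSpace.exp (t • Mᵀ) * Y * NormedSpace.exp (t • M))
  let f : ℝ → ℝ := fun t => (S * X).trace +
    ψ (NormedSpace.exp (t • Mᵀ) * S * NormedSpace.exp (t • M))
  have hF (t : ℝ) : HasDerivAt F (f t) t := by
    have h := ((hasDerivAt_id t).const_mul (S * X).trace).sub
      ((Matrix.hasDerivAt_exp_mul_exp Mᵀ M Y t).linearMap_comp ψ)
    have hneg : NormedSpace.exp (t • Mᵀ) * (Mᵀ * Y + Y * M) * NormedSpace.exp (t • M) =
        -(NormedSpace.exp (t • Mᵀ) * S * NormedSpace.exp (t • M)) := by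
      rw [hSY, mul_neg, neg_mul, neg_neg]
    rw [hneg, map_neg, sub_neg_eq_add, mul_one] at h
    exact h
  have hf : Continuous f := by
    have h1 : Continuous fun t : ℝ => NormedSpace.exp (t • Mᵀ) * S * NormedSpace.exp (t • M) :=
      (Mᵀ.continuous_exp_smul.mul continuous_const).mul M.continuous_exp_smul
    exact continuous_const.add ((LinearMap.continuous_of_finiteDimensional ψ).comp h1)
  have hexpect {t : ℝ} (ht : 0 ≤ t) : ∫ z, D.runningCost K z ∂(D.stateLaw z₀ K t) = f t := by
    simp only [runningCost_eq, stateLaw]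
    rw [integral_quadForm_multivariateGaussian _ (stateCov_posSemidef hW hV K ht),
      stateCov_eq D K hX]
    simp only [stateMean, f, hψ, ← hM, ← hS, ← hz]
    rw [← Matrix.dotProduct_transpose_mul_mul_mulVec, ← Matrix.exp_smul_transpose, mul_sub,
      Matrix.trace_sub, ← Matrix.trace_mul_conj_comm]
    ring
  -- What remains besides `tr (S X)` is a bounded quantity divided by `T`.
  have havg : ∀ᶠ T : ℝ in atTop, (S * X).trace +
      (1 / T) * (ψ Y - ψ (NormedSpace.exp (T • Mᵀ) * Y * NormedSpace.exp (T • M))) =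
      D.averageCost z₀ K T := by
    filter_upwards [eventually_gt_atTop 0] with T hT
    have hint : ∫ t in (0 : ℝ)..T, ∫ z, D.runningCost K z ∂(D.stateLaw z₀ K t) = F T - F 0 := by
      rw [← intervalIntegral.integral_eq_sub_of_hasDerivAt (fun t _ => hF t)
        (hf.intervalIntegrable 0 T)]
      refine intervalIntegral.integral_congr fun t ht => hexpect ?_
      rw [Set.uIcc_of_le hT.le] at ht
      exact ht.1
    rw [averageCost, hint]
    simp only [F, zero_smul, NormedSpace.exp_zero, one_mul, mul_one, mul_zero]
    field_simp
    ring
  refine Tendsto.congr' havg ?_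
  have h1 := ((LinearMap.continuous_of_finiteDimensional ψ).tendsto 0).comp
    (hK.transpose.tendsto_mul_mul hK Y)
  have h2 : Tendsto (fun T : ℝ => 1 / T) atTop (𝓝 0) := by
    simpa using tendsto_inv_atTop_zero (𝕜 := ℝ)
  have h3 := (h2.mul (h1.const_sub (ψ Y))).const_add (S * X).trace
  simpa using h3

theorem cost_eq_trace {D : LQGData n m p} (hW : D.W.PosSemidef) (hV : D.V.PosSemidef)
    (z₀ : EuclideanSpace ℝ (n ⊕ q)) {K : Controller m p q} (hK : (D.closedLoop K).IsExpStable)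
    {X : Matrix (n ⊕ q) (n ⊕ q) ℝ}
    (hX : D.closedLoop K * X + X * (D.closedLoop K)ᵀ + D.noiseIntensity K = 0) :
    D.cost z₀ K = (D.costWeight K * X).trace :=
  (tendsto_averageCost hW hV z₀ hK hX).limUnder_eq

end LQGData

/-! ## Smooth dependence of the Lyapunov solution -/

section SylvesterOperator

variable {A : Type*} [NormedRing A] [NormedAlgebra ℝ A]

/-- The Sylvester operator `x ↦ a x + x b`. -/
noncomputable def sylvesterOp (a b : A) : A →L[ℝ] A :=
  ContinuousLinearMap.mul ℝ A a + (ContinuousLinearMap.mul ℝ A).flip b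

theorem sylvesterOp_apply (a b x : A) : sylvesterOp a b x = a * x + x * b := rfl

/-- The solution `x` of the Sylvester equation `a x + x b + c = 0`. -/
noncomputable def sylvesterSol (a b c : A) : A := -(Ring.inverse (sylvesterOp a b) c)

/-- In finite dimension an injective endomorphism is invertible, so uniqueness for the Sylvester
equation is enough. -/
theorem isUnit_sylvesterOp [FiniteDimensional ℝ A] {a b : A}
    (hinj : ∀ x, a * x + x * b = 0 → x = 0) : IsUnit (sylvesterOp a b) := by
  have h : Function.Injective (sylvesterOp a b : A →ₗ[ℝ] A) :=
    (injective_iff_map_eq_zero _).2 fun x hx => hinj x hx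
  let e : A ≃L[ℝ] A := (LinearEquiv.ofInjectiveEndo (sylvesterOp a b : A →ₗ[ℝ] A) h).toContinuousLinearEquiv
  exact ⟨(ContinuousLinearEquiv.unitsEquiv ℝ A).symm e, by ext x : 1; rfl⟩

theorem sylvesterSol_spec {a b : A} (h : IsUnit (sylvesterOp a b)) (c : A) :
    a * sylvesterSol a b c + sylvesterSol a b c * b + c = 0 := by
  rw [← sylvesterOp_apply, sylvesterSol, map_neg]
  have h1 := congrArg (fun T : A →L[ℝ] A => T c) (Ring.mul_inverse_cancel _ h)
  exact (congrArg (fun y => -y + c) h1).trans (neg_add_cancel c)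

/-- The operator depends linearly on its coefficients, and inversion is smooth at the units of the
Banach algebra of operators. -/
theorem contDiffAt_sylvesterSol [CompleteSpace A] {F : Type*} [NormedAddCommGroup F]
    [NormedSpace ℝ F] {a b c : F → A} {x : F} {k : WithTop ℕ∞}
    (hx : IsUnit (sylvesterOp (a x) (b x))) (ha : ContDiff ℝ k a) (hb : ContDiff ℝ k b)
    (hc : ContDiff ℝ k c) : ContDiffAt ℝ k (fun y => sylvesterSol (a y) (b y) (c y)) x := by
  have hL : ContDiff ℝ k fun y => sylvesterOp (a y) (b y) :=
    ((ContinuousLinearMap.mul ℝ A).contDiff.comp ha).add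
      ((ContinuousLinearMap.mul ℝ A).flip.contDiff.comp hb)
  obtain ⟨u, hu⟩ := hx
  have hinv : ContDiffAt ℝ k (fun y => Ring.inverse (sylvesterOp (a y) (b y))) x := by
    refine ContDiffAt.comp (g := Ring.inverse) x ?_ hL.contDiffAt
    rw [← hu]
    exact contDiffAt_ringInverse ℝ u
  exact (hinv.clm_apply hc.contDiffAt).neg

end SylvesterOperator

section LyapunovSolution

open scoped Matrix.Norms.Operator

variable {ι : Type*} [Fintype ι] [DecidableEq ι]

theorem ContDiff.matrix {F : Type*} [NormedAddCommGroup F] [NormedSpace ℝ F] {k : WithTop ℕ∞}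
    {f : F → Matrix ι ι ℝ} (hf : ∀ i j, ContDiff ℝ k fun x => f x i j) : ContDiff ℝ k f := by
  have h : f = fun x => ∑ i, ∑ j, f x i j • Matrix.single i j (1 : ℝ) := by
    ext x : 1
    simpa [Matrix.smul_single] using Matrix.matrix_eq_sum_single (f x)
  rw [h]
  exact ContDiff.sum fun i _ => ContDiff.sum fun j _ => (hf i j).smul contDiff_const

theorem Matrix.IsExpStable.isUnit_sylvesterOp {M : Matrix ι ι ℝ} (hM : M.IsExpStable) :
    IsUnit (sylvesterOp M Mᵀ) :=
  _root_.isUnit_sylvesterOp fun _ hX => hM.eq_zero_of_sylvester hM.transpose hX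

/-- The solution `X` of the Lyapunov equation `M X + X Mᵀ + N = 0`. -/
noncomputable def Matrix.lyapunovSol (M N : Matrix ι ι ℝ) : Matrix ι ι ℝ :=
  sylvesterSol M Mᵀ N

theorem Matrix.IsExpStable.lyapunovSol_spec {M : Matrix ι ι ℝ} (hM : M.IsExpStable)
    (N : Matrix ι ι ℝ) : M * M.lyapunovSol N + M.lyapunovSol N * Mᵀ + N = 0 :=
  sylvesterSol_spec hM.isUnit_sylvesterOp N

theorem Matrix.IsExpStable.lyapunovSol_unique {M N X : Matrix ι ι ℝ} (hM : M.IsExpStable)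
    (hX : M * X + X * Mᵀ + N = 0) : X = M.lyapunovSol N := by
  refine sub_eq_zero.1 (hM.eq_zero_of_sylvester hM.transpose ?_)
  have h := congrArg₂ (· - ·) hX (hM.lyapunovSol_spec N)
  simp only [sub_zero] at h
  rw [← h]
  noncomm_ring

theorem Matrix.IsExpStable.contDiffAt_lyapunovSol {F : Type*} [NormedAddCommGroup F]
    [NormedSpace ℝ F] {M N : F → Matrix ι ι ℝ} {x : F} {k : WithTop ℕ∞} (hx : (M x).IsExpStable)
    (hM : ContDiff ℝ k M) (hN : ContDiff ℝ k N) :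
    ContDiffAt ℝ k (fun y => (M y).lyapunovSol (N y)) x :=
  contDiffAt_sylvesterSol hx.isUnit_sylvesterOp hM
    ((LinearMap.toContinuousLinearMap
      (Matrix.transposeLinearEquiv ι ι ℝ ℝ).toLinearMap).contDiff.comp hM) hN

end LyapunovSolution

/-! ## Second derivatives along lines -/

section SecondDerivative

variable {E : Type*} [NormedAddCommGroup E] [NormedSpace ℝ E]

theorem iteratedDeriv_two (φ : ℝ → ℝ) : iteratedDeriv 2 φ = deriv (deriv φ) := by
  rw [show 2 = 1 + 1 from rfl, iteratedDeriv_succ, iteratedDeriv_one]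

theorem hasDerivAt_add_smul (x v : E) (t : ℝ) : HasDerivAt (fun s : ℝ => x + s • v) v t := by
  simpa using ((hasDerivAt_id t).smul_const v).const_add x

theorem ContDiffAt.hasDerivAt_line {f : E → ℝ} {x v : E} (hf : ContDiffAt ℝ 2 f x) :
    HasDerivAt (fun t : ℝ => f (x + t • v)) (fderiv ℝ f x v) 0 := by
  have h : HasFDerivAt f (fderiv ℝ f x) (x + (0 : ℝ) • v) := by
    simpa using (hf.differentiableAt (by norm_num)).hasFDerivAt
  exact h.comp_hasDerivAt 0 (hasDerivAt_add_smul x v 0)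

theorem ContDiffAt.fderiv_fderiv_apply_self {f : E → ℝ} {x v : E} (hf : ContDiffAt ℝ 2 f x) :
    fderiv ℝ (fderiv ℝ f) x v v = iteratedDeriv 2 (fun t : ℝ => f (x + t • v)) 0 := by
  have hline : Tendsto (fun t : ℝ => x + t • v) (𝓝 0) (𝓝 x) := by
    simpa using (hasDerivAt_add_smul x v 0).continuousAt.tendsto
  have hev : ∀ᶠ y in 𝓝 x, DifferentiableAt ℝ f y :=
    (hf.eventually (by simp)).mono fun y hy => hy.differentiableAt (by norm_num)
  have hderiv : deriv (fun t : ℝ => f (x + t • v)) =ᶠ[𝓝 0]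
      fun t => fderiv ℝ f (x + t • v) v := by
    filter_upwards [hline.eventually hev] with t ht
    exact (ht.hasFDerivAt.comp_hasDerivAt t (hasDerivAt_add_smul x v t)).deriv
  have hf' : HasFDerivAt (fderiv ℝ f) (fderiv ℝ (fderiv ℝ f) x) (x + (0 : ℝ) • v) := by
    have h : ContDiffAt ℝ 1 (fderiv ℝ f) x := hf.fderiv_right (by norm_num)
    simpa using (h.differentiableAt (by norm_num)).hasFDerivAt
  have h1 := hf'.comp_hasDerivAt (0 : ℝ) (hasDerivAt_add_smul x v 0)
  have h2 : HasDerivAt (fun t : ℝ => fderiv ℝ f (x + t • v) v)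
      (fderiv ℝ (fderiv ℝ f) x v v) 0 := by
    simpa using h1.clm_apply (hasDerivAt_const 0 v)
  rw [iteratedDeriv_two, hderiv.deriv_eq, h2.deriv]

/-- The factor `t` lowers the order needed from `ψ`: the second derivative of `t * ψ t` at `0` is `2
ψ'(0)`. Smoothness of order two is used only to know that `t * deriv ψ t` is differentiable. -/
theorem derivs_of_eventuallyEq_add_mul {φ ψ : ℝ → ℝ} {a₀ a₁ a₂ ψ' : ℝ}
    (hφ : φ =ᶠ[𝓝 0] fun t => a₀ + a₁ * t + a₂ * t ^ 2 + t * ψ t) (hψ : ContDiffAt ℝ 2 ψ 0)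
    (hψ' : HasDerivAt ψ ψ' 0) :
    HasDerivAt φ (a₁ + ψ 0) 0 ∧ iteratedDeriv 2 φ 0 = 2 * a₂ + 2 * ψ' := by
  have hpoly (t : ℝ) : HasDerivAt (fun t => a₀ + a₁ * t + a₂ * t ^ 2) (a₁ + a₂ * (2 * t)) t := by
    simpa using (((hasDerivAt_id t).const_mul a₁).const_add a₀).fun_add
      ((hasDerivAt_pow 2 t).const_mul a₂)
  have hder {t : ℝ} (ht : DifferentiableAt ℝ ψ t) :
      HasDerivAt (fun t => a₀ + a₁ * t + a₂ * t ^ 2 + t * ψ t)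
        (a₁ + a₂ * (2 * t) + (1 * ψ t + t * deriv ψ t)) t :=
    (hpoly t).fun_add ((hasDerivAt_id t).fun_mul ht.hasDerivAt)
  refine ⟨?_, ?_⟩
  · have h := (hder hψ'.differentiableAt).congr_of_eventuallyEq hφ
    simpa using h
  have hev : deriv φ =ᶠ[𝓝 0] fun t => a₁ + a₂ * (2 * t) + (1 * ψ t + t * deriv ψ t) := by
    filter_upwards [hφ.eventuallyEq_nhds, hψ.eventually (by simp)] with t ht hψt
    rw [ht.deriv_eq, (hder (hψt.differentiableAt (by norm_num))).deriv]
  have hψ'' : DifferentiableAt ℝ (deriv ψ) 0 := by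
    have h : ContDiffAt ℝ 1 (deriv ψ) 0 := by
      have h1 : ContDiffAt ℝ 1 (fderiv ℝ ψ) 0 := hψ.fderiv_right (by norm_num)
      simpa using h1.clm_apply (contDiffAt_const (c := (1 : ℝ)))
    exact h.differentiableAt (by norm_num)
  rw [iteratedDeriv_two, hev.deriv_eq]
  have h1 := (((hasDerivAt_id (0 : ℝ)).const_mul 2).const_mul a₂).const_add a₁
  have h2 := (hψ'.const_mul 1).add ((hasDerivAt_id (0 : ℝ)).mul hψ''.hasDerivAt)
  have h := (h1.add h2).deriv
  simp only [id_eq, one_mul, zero_mul, add_zero, hψ'.deriv] at h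
  refine Eq.trans ?_ (h.trans (by ring))
  congr 1
  ext t
  simp

end SecondDerivative

/-! ## Perturbation of the LQG cost -/

namespace LQGData

open scoped Matrix.Norms.Operator

variable {n m p q : Type} [Fintype n] [Fintype m] [Fintype p] [Fintype q]
  [DecidableEq n] [DecidableEq m] [DecidableEq p] [DecidableEq q]

/-- Derivative of the closed-loop matrix in the direction `Δ`. -/
def closedLoopDir (D : LQGData n m p) (Δ : Controller m p q) : Matrix (n ⊕ q) (n ⊕ q) ℝ :=
  Matrix.fromBlocks 0 (D.B * Δ.CK) (Δ.BK * D.C) Δ.AK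

/-- Derivative of the noise intensity at `K` in the direction `Δ`. -/
def noiseDir (D : LQGData n m p) (K Δ : Controller m p q) : Matrix (n ⊕ q) (n ⊕ q) ℝ :=
  Matrix.fromBlocks 0 0 0 (K.BK * D.V * Δ.BKᵀ + Δ.BK * D.V * K.BKᵀ)

/-- Second-order part of the noise intensity in the direction `Δ`. -/
def noiseQuad (D : LQGData n m p) (Δ : Controller m p q) : Matrix (n ⊕ q) (n ⊕ q) ℝ :=
  Matrix.fromBlocks 0 0 0 (Δ.BK * D.V * Δ.BKᵀ)

/-- Derivative of the cost weight at `K` in the direction `Δ`. -/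
def weightDir (D : LQGData n m p) (K Δ : Controller m p q) : Matrix (n ⊕ q) (n ⊕ q) ℝ :=
  Matrix.fromBlocks 0 0 0 (K.CKᵀ * D.R * Δ.CK + Δ.CKᵀ * D.R * K.CK)

/-- Second-order part of the cost weight in the direction `Δ`. -/
def weightQuad (D : LQGData n m p) (Δ : Controller m p q) : Matrix (n ⊕ q) (n ⊕ q) ℝ :=
  Matrix.fromBlocks 0 0 0 (Δ.CKᵀ * D.R * Δ.CK)

theorem _root_.Controller.CK_add_smul (K Δ : Controller m p q) (t : ℝ) :
    (K + t • Δ).CK = K.CK + t • Δ.CK := rfl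

theorem _root_.Controller.BK_add_smul (K Δ : Controller m p q) (t : ℝ) :
    (K + t • Δ).BK = K.BK + t • Δ.BK := rfl

theorem _root_.Controller.AK_add_smul (K Δ : Controller m p q) (t : ℝ) :
    (K + t • Δ).AK = K.AK + t • Δ.AK := rfl

theorem closedLoop_add_smul (D : LQGData n m p) (K Δ : Controller m p q) (t : ℝ) :
    D.closedLoop (K + t • Δ) = D.closedLoop K + t • D.closedLoopDir Δ := by
  simp [closedLoop, closedLoopDir, Controller.CK_add_smul, Controller.BK_add_smul,
    Controller.AK_add_smul, Matrix.fromBlocks_smul, Matrix.fromBlocks_add, Matrix.mul_add,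
    Matrix.add_mul]

theorem noiseIntensity_add_smul (D : LQGData n m p) (K Δ : Controller m p q) (t : ℝ) :
    D.noiseIntensity (K + t • Δ) =
      D.noiseIntensity K + t • D.noiseDir K Δ + t ^ 2 • D.noiseQuad Δ := by
  simp only [noiseIntensity, noiseDir, noiseQuad, Controller.BK_add_smul, Matrix.fromBlocks_smul,
    Matrix.fromBlocks_add, Matrix.mul_add, Matrix.add_mul, Matrix.transpose_add,
    Matrix.transpose_smul, Matrix.smul_mul, Matrix.mul_smul, smul_zero, add_zero]
  congr 1
  module

theorem costWeight_add_smul (D : LQGData n m p) (K Δ : Controller m p q) (t : ℝ) :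
    D.costWeight (K + t • Δ) =
      D.costWeight K + t • D.weightDir K Δ + t ^ 2 • D.weightQuad Δ := by
  simp only [costWeight, weightDir, weightQuad, Controller.CK_add_smul, Matrix.fromBlocks_smul,
    Matrix.fromBlocks_add, Matrix.mul_add, Matrix.add_mul, Matrix.transpose_add,
    Matrix.transpose_smul, Matrix.smul_mul, Matrix.mul_smul, smul_zero, add_zero]
  congr 1
  module

theorem contDiff_closedLoop (D : LQGData n m p) {k : WithTop ℕ∞} :
    ContDiff ℝ k (D.closedLoop : Controller m p q → _) := by
  refine ContDiff.matrix fun i j => ?_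
  rcases i with i | i <;> rcases j with j | j <;>
    simp only [closedLoop, Matrix.fromBlocks_apply₁₁, Matrix.fromBlocks_apply₁₂,
      Matrix.fromBlocks_apply₂₁, Matrix.fromBlocks_apply₂₂, Matrix.mul_apply, Controller.CK,
      Controller.BK, Controller.AK, Matrix.of_apply] <;> fun_prop

theorem continuous_closedLoop (D : LQGData n m p) :
    Continuous (D.closedLoop : Controller m p q → _) :=
  (D.contDiff_closedLoop (k := 0)).continuous

theorem contDiff_noiseIntensity (D : LQGData n m p) {k : WithTop ℕ∞} :
    ContDiff ℝ k (D.noiseIntensity : Controller m p q → _) := by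
  refine ContDiff.matrix fun i j => ?_
  rcases i with i | i <;> rcases j with j | j <;>
    simp only [noiseIntensity, Matrix.fromBlocks_apply₁₁, Matrix.fromBlocks_apply₁₂,
      Matrix.fromBlocks_apply₂₁, Matrix.fromBlocks_apply₂₂, Matrix.mul_apply,
      Controller.BK, Matrix.of_apply, Matrix.transpose_apply] <;> fun_prop

theorem contDiff_costWeight (D : LQGData n m p) {k : WithTop ℕ∞} :
    ContDiff ℝ k (D.costWeight : Controller m p q → _) := by
  refine ContDiff.matrix fun i j => ?_
  rcases i with i | i <;> rcases j with j | j <;>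
    simp only [costWeight, Matrix.fromBlocks_apply₁₁, Matrix.fromBlocks_apply₁₂,
      Matrix.fromBlocks_apply₂₁, Matrix.fromBlocks_apply₂₂, Matrix.mul_apply,
      Controller.CK, Matrix.of_apply, Matrix.transpose_apply] <;> fun_prop

/-- The trace formula for the cost is available only where the closed loop is stable, hence
stability is required on a neighbourhood and not just at `K`. -/
theorem contDiffAt_cost {D : LQGData n m p} (hW : D.W.PosSemidef) (hV : D.V.PosSemidef)
    (z₀ : EuclideanSpace ℝ (n ⊕ q)) {K : Controller m p q}
    (hK : ∀ᶠ K' in 𝓝 K, (D.closedLoop K').IsExpStable) {k : WithTop ℕ∞} :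
    ContDiffAt ℝ k (D.cost z₀) K := by
  have hsol := hK.self_of_nhds.contDiffAt_lyapunovSol (k := k) (N := D.noiseIntensity)
    D.contDiff_closedLoop D.contDiff_noiseIntensity
  have hmul := D.contDiff_costWeight.contDiffAt.mul hsol
  refine ((LinearMap.toContinuousLinearMap (Matrix.traceLinearMap (n ⊕ q) ℝ ℝ)).contDiff.contDiffAt.comp
    K hmul).congr_of_eventuallyEq ?_
  filter_upwards [hK] with K' hK'
  exact cost_eq_trace hW hV z₀ hK' (hK'.lyapunovSol_spec _)

/-- First and second derivative of the cost along a line, through the stationary covariance `X`, its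
dual `Y` and the derivative `X₁` of `X`. -/
theorem cost_line_derivs {D : LQGData n m p} (hW : D.W.PosSemidef) (hV : D.V.PosSemidef)
    (z₀ : EuclideanSpace ℝ (n ⊕ q)) {K Δ : Controller m p q}
    (hK : ∀ᶠ K' in 𝓝 K, (D.closedLoop K').IsExpStable) {X Y X₁ : Matrix (n ⊕ q) (n ⊕ q) ℝ}
    (hX : D.closedLoop K * X + X * (D.closedLoop K)ᵀ + D.noiseIntensity K = 0)
    (hY : (D.closedLoop K)ᵀ * Y + Y * D.closedLoop K + D.costWeight K = 0)
    (hX₁ : D.closedLoop K * X₁ + X₁ * (D.closedLoop K)ᵀ + (D.closedLoopDir Δ * X +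
      X * (D.closedLoopDir Δ)ᵀ + D.noiseDir K Δ) = 0) :
    HasDerivAt (fun t : ℝ => D.cost z₀ (K + t • Δ)) ((Y * D.noiseDir K Δ).trace +
      ((D.weightDir K Δ + Y * D.closedLoopDir Δ + (D.closedLoopDir Δ)ᵀ * Y) * X).trace) 0 ∧
    iteratedDeriv 2 (fun t : ℝ => D.cost z₀ (K + t • Δ)) 0 =
      2 * (Y * D.noiseQuad Δ).trace + 2 * ((D.weightQuad Δ * X).trace +
      ((D.weightDir K Δ + Y * D.closedLoopDir Δ + (D.closedLoopDir Δ)ᵀ * Y) * X₁).trace) := by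
  set M := D.closedLoop K with hM
  set M₁ := D.closedLoopDir Δ with hM₁
  set N₁ := D.noiseDir K Δ
  have hline : Tendsto (fun t : ℝ => K + t • Δ) (𝓝 0) (𝓝 K) := by
    simpa using (hasDerivAt_add_smul K Δ 0).continuousAt.tendsto
  have hstab := hline.eventually hK
  let Z : ℝ → Matrix (n ⊕ q) (n ⊕ q) ℝ := fun t =>
    (D.closedLoop (K + t • Δ)).lyapunovSol (D.noiseIntensity (K + t • Δ))
  have hZsmooth : ContDiffAt ℝ 2 Z 0 := by
    have hlineSmooth : ContDiff ℝ 2 fun t : ℝ => K + t • Δ := by fun_prop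
    refine Matrix.IsExpStable.contDiffAt_lyapunovSol (M := fun t : ℝ => D.closedLoop (K + t • Δ))
      hstab.self_of_nhds (D.contDiff_closedLoop.comp hlineSmooth)
      (D.contDiff_noiseIntensity.comp hlineSmooth)
  have hZeq : ∀ᶠ t : ℝ in 𝓝 0, M * Z t + Z t * Mᵀ + t • (M₁ * Z t + Z t * M₁ᵀ) +
      (D.noiseIntensity K + t • N₁ + t ^ 2 • D.noiseQuad Δ) = 0 := by
    filter_upwards [hstab] with t ht
    have h := ht.lyapunovSol_spec (D.noiseIntensity (K + t • Δ))
    rw [noiseIntensity_add_smul] at h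
    rw [← h]
    simp only [Z, noiseIntensity_add_smul, closedLoop_add_smul, Matrix.transpose_add,
      Matrix.transpose_smul, add_mul, mul_add, smul_mul_assoc, mul_smul_comm, smul_add, ← hM,
      ← hM₁]
    abel
  have hZ0 : Z 0 = X := by
    have h := hK.self_of_nhds.lyapunovSol_unique hX
    simpa [Z, ← hM] using h.symm
  have hZdiff : HasDerivAt Z (deriv Z 0) 0 :=
    (hZsmooth.differentiableAt (by norm_num)).hasDerivAt
  -- Differentiating the Lyapunov equation of `Z` at `0` gives the equation of `X₁`, and uniqueness
  -- identifies the two.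
  have hZ' : HasDerivAt Z X₁ 0 := by
    have h1 := ((hZdiff.const_mul M).add (hZdiff.mul_const Mᵀ)).add
      ((hasDerivAt_id (0 : ℝ)).smul ((hZdiff.const_mul M₁).add (hZdiff.mul_const M₁ᵀ)))
    have h2 := (((hasDerivAt_id (0 : ℝ)).smul_const N₁).const_add (D.noiseIntensity K)).add
      ((hasDerivAt_pow 2 (0 : ℝ)).smul_const (D.noiseQuad Δ))
    have h3 := (h1.add h2).unique ((hasDerivAt_const (0 : ℝ) _).congr_of_eventuallyEq hZeq)
    have h4 : M * deriv Z 0 + deriv Z 0 * Mᵀ + (M₁ * X + X * M₁ᵀ + N₁) = 0 := by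
      simpa [hZ0, add_assoc] using h3
    have h5 := (hK.self_of_nhds.lyapunovSol_unique h4).trans
      (hK.self_of_nhds.lyapunovSol_unique hX₁).symm
    rwa [h5] at hZdiff
  let G : ℝ → Matrix (n ⊕ q) (n ⊕ q) ℝ := fun t =>
    D.weightDir K Δ + Y * M₁ + M₁ᵀ * Y + t • D.weightQuad Δ
  have hG : HasDerivAt G (D.weightQuad Δ) 0 := hasDerivAt_add_smul _ _ 0
  have hGsmooth : ContDiff ℝ 2 G := by fun_prop
  let τ := Matrix.traceLinearMap (n ⊕ q) ℝ ℝ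
  let ψ : ℝ → ℝ := fun t => τ (G t * Z t)
  have hψ : ContDiffAt ℝ 2 ψ 0 :=
    (LinearMap.toContinuousLinearMap τ).contDiff.contDiffAt.comp 0
      (hGsmooth.contDiffAt.mul hZsmooth)
  have hψ' : HasDerivAt ψ (τ (D.weightQuad Δ * Z 0 + G 0 * X₁)) 0 :=
    (hG.mul hZ').linearMap_comp τ
  -- Substitute the dual equation for the weight in `tr (S Z)` and use the equation of `Z`
  -- multiplied by `Y`: the zeroth-order occurrences of `Z` cancel, leaving `Z` only with a factor
  -- `t`.
  have hcost : (fun t : ℝ => D.cost z₀ (K + t • Δ)) =ᶠ[𝓝 0] fun t =>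
      (Y * D.noiseIntensity K).trace + (Y * N₁).trace * t + (Y * D.noiseQuad Δ).trace * t ^ 2 +
        t * ψ t := by
    filter_upwards [hstab, hZeq] with t ht hZt
    rw [cost_eq_trace hW hV z₀ ht (ht.lyapunovSol_spec _), costWeight_add_smul]
    have hw : D.costWeight K = -(Mᵀ * Y + Y * M) := (neg_eq_of_add_eq_zero_right hY).symm
    have h := congrArg (fun A => (Y * A).trace) hZt
    change (_ * Z t).trace = _
    rw [hw]
    simp only [ψ, τ, G, Matrix.traceLinearMap_apply, mul_add, add_mul, Matrix.trace_add, mul_zero,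
      Matrix.trace_zero, neg_mul, Matrix.trace_neg, smul_mul_assoc, mul_smul_comm, smul_eq_mul,
      Matrix.trace_smul, ← mul_assoc] at h ⊢
    have hc (A : Matrix (n ⊕ q) (n ⊕ q) ℝ) : (Y * Z t * Aᵀ).trace = (Aᵀ * Y * Z t).trace := by
      rw [Matrix.trace_mul_comm, mul_assoc]
    rw [hc, hc] at h
    linear_combination -h
  have hmain := derivs_of_eventuallyEq_add_mul hcost hψ hψ'
  simpa [ψ, τ, G, hZ0] using hmain

end LQGData

/-! ## Similarity transformations and tangent vectors of orbits -/

namespace Controller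

variable {m p q : Type} [Fintype m] [Fintype p] [Fintype q] [DecidableEq q]

@[simp]
theorem CK_ofBlocks (C : Matrix m q ℝ) (B : Matrix q p ℝ) (A : Matrix q q ℝ) :
    (ofBlocks C B A).CK = C := rfl

@[simp]
theorem BK_ofBlocks (C : Matrix m q ℝ) (B : Matrix q p ℝ) (A : Matrix q q ℝ) :
    (ofBlocks C B A).BK = B := rfl

@[simp]
theorem AK_ofBlocks (C : Matrix m q ℝ) (B : Matrix q p ℝ) (A : Matrix q q ℝ) :
    (ofBlocks C B A).AK = A := rfl

theorem ext_blocks {K L : Controller m p q} (hC : K.CK = L.CK) (hB : K.BK = L.BK)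
    (hA : K.AK = L.AK) : K = L := by
  ext i
  rcases i with ⟨i, j⟩ | ⟨i, j⟩ | ⟨i, j⟩
  · exact congrFun₂ hC i j
  · exact congrFun₂ hB i j
  · exact congrFun₂ hA i j

/-- A similarity transformation as a linear map. -/
def similarityLinear (T : GL q ℝ) : Controller m p q →ₗ[ℝ] Controller m p q where
  toFun := similarity T
  map_add' K L := by
    apply ext_blocks
    · exact Matrix.add_mul K.CK L.CK _
    · exact Matrix.mul_add _ K.BK L.BK
    · change _ * (K.AK + L.AK) * _ = _ * K.AK * _ + _ * L.AK * _
      rw [Matrix.mul_add, Matrix.add_mul]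
  map_smul' c K := by
    apply ext_blocks
    · exact Matrix.smul_mul c K.CK _
    · exact Matrix.mul_smul _ c K.BK
    · change _ * (c • K.AK) * _ = c • (_ * K.AK * _)
      rw [Matrix.mul_smul, Matrix.smul_mul]

theorem similarity_mul (S T : GL q ℝ) (K : Controller m p q) :
    similarity S (similarity T K) = similarity (S * T) K := by
  apply ext_blocks <;> simp [similarity, mul_assoc, Matrix.mul_assoc]

theorem similarity_one (K : Controller m p q) : similarity (1 : GL q ℝ) K = K := by
  apply ext_blocks <;> simp [similarity]

/-- The differential at `1` of `T ↦ 𝒯(T, K)`. -/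
def orbitDifferential (K : Controller m p q) : Matrix q q ℝ →ₗ[ℝ] Controller m p q where
  toFun H := ofBlocks (-(K.CK * H)) (H * K.BK) (H * K.AK - K.AK * H)
  map_add' H L := by
    apply ext_blocks
    · change -(K.CK * (H + L)) = -(K.CK * H) + -(K.CK * L)
      rw [Matrix.mul_add, neg_add]
    · exact Matrix.add_mul H L K.BK
    · change (H + L) * K.AK - K.AK * (H + L) = (H * K.AK - K.AK * H) + (L * K.AK - K.AK * L)
      noncomm_ring
  map_smul' c H := by
    apply ext_blocks
    · change -(K.CK * (c • H)) = c • -(K.CK * H)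
      rw [Matrix.mul_smul, smul_neg]
    · exact Matrix.smul_mul c H K.BK
    · change (c • H) * K.AK - K.AK * (c • H) = c • (H * K.AK - K.AK * H)
      rw [Matrix.smul_mul, Matrix.mul_smul, smul_sub]

theorem orbitDifferential_apply (K : Controller m p q) (H : Matrix q q ℝ) :
    orbitDifferential K H = ofBlocks (-(K.CK * H)) (H * K.BK) (H * K.AK - K.AK * H) := rfl

theorem hasDerivAt_matrix_mul_apply {a b c : Type*} [Fintype b] {F : ℝ → Matrix a b ℝ}
    {G : ℝ → Matrix b c ℝ} {F' : Matrix a b ℝ} {G' : Matrix b c ℝ} {t : ℝ}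
    (hF : ∀ i j, HasDerivAt (fun s => F s i j) (F' i j) t)
    (hG : ∀ i j, HasDerivAt (fun s => G s i j) (G' i j) t) (i : a) (j : c) :
    HasDerivAt (fun s => (F s * G s) i j) ((F' * G t + F t * G') i j) t := by
  simp only [Matrix.add_apply, Matrix.mul_apply, ← Finset.sum_add_distrib]
  exact HasDerivAt.fun_sum fun k _ => (hF i k).mul (hG k j)

/-- Tangent vectors of the orbit of a controller with `B_K F + A_K B_K G = 1`, for instance a
controllable one of order two, come from the differential of the group action. -/
theorem tangentVectors_orbit_subset {K : Controller m p q} {F G : Matrix p q ℝ}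
    (hFG : K.BK * F + K.AK * K.BK * G = 1) :
    tangentVectors K.orbit K ⊆ LinearMap.range (orbitDifferential K) := by
  rintro v ⟨γ, -, hγ, hγ0, hv⟩
  have hcoord (i) : HasDerivAt (fun t => γ t i) (v i) 0 :=
    (EuclideanSpace.proj (𝕜 := ℝ) i).hasFDerivAt.comp_hasDerivAt (0 : ℝ) hv
  have hC (i j) : HasDerivAt (fun t => (γ t).CK i j) (v.CK i j) 0 := hcoord _
  have hB (i j) : HasDerivAt (fun t => (γ t).BK i j) (v.BK i j) 0 := hcoord _
  have hA (i j) : HasDerivAt (fun t => (γ t).AK i j) (v.AK i j) 0 := hcoord _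
  have hconst {a b : Type _} (S : Matrix a b ℝ) (i j) :
      HasDerivAt (fun _ : ℝ => S i j) ((0 : Matrix a b ℝ) i j) 0 := hasDerivAt_const _ _
  -- On the orbit `(T B) F + (T A T⁻¹)(T B) G = T (B F + A B G) = T`, so `θ` recovers the
  -- transformation from the controller and is differentiable along the curve. Its derivative `H`
  -- will be the preimage of `v`.
  let θ : ℝ → Matrix q q ℝ := fun t => (γ t).BK * F + (γ t).AK * (γ t).BK * G
  let H : Matrix q q ℝ := v.BK * F + (v.AK * K.BK + K.AK * v.BK) * G
  have hθ (i j) : HasDerivAt (fun t => θ t i j) (H i j) 0 := by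
    have h := (hasDerivAt_matrix_mul_apply hB (hconst F) i j).fun_add
      (hasDerivAt_matrix_mul_apply (hasDerivAt_matrix_mul_apply hA hB) (hconst G) i j)
    simp only [hγ0, Matrix.mul_zero, add_zero] at h
    exact h
  have hθ0 : θ 0 = 1 := by simp only [θ, hγ0, hFG]
  -- The orbit relations are freed of `T⁻¹`, so that the product rule at `θ 0 = 1` yields the three
  -- blocks directly.
  have hT : ∀ᶠ t : ℝ in 𝓝 0, (γ t).CK * θ t = K.CK ∧ (γ t).BK = θ t * K.BK ∧
      (γ t).AK * θ t = θ t * K.AK := by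
    filter_upwards [Ioo_mem_nhds (by norm_num : (-1 : ℝ) < 0) (by norm_num : (0 : ℝ) < 1)]
      with t ht
    obtain ⟨T, hT⟩ := hγ t ht
    have hinv : (↑T⁻¹ : Matrix q q ℝ) * (↑T : Matrix q q ℝ) = 1 := by
      rw [← Units.val_mul, inv_mul_cancel, Units.val_one]
    have hTθ : θ t = (↑T : Matrix q q ℝ) := by
      calc θ t = (↑T : Matrix q q ℝ) * (K.BK * F + K.AK * ((↑T⁻¹ : Matrix q q ℝ) *
            (↑T : Matrix q q ℝ)) * K.BK * G) := by
              simp only [θ, ← hT, similarity, BK_ofBlocks, AK_ofBlocks, Matrix.mul_add,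
                Matrix.mul_assoc]
        _ = (↑T : Matrix q q ℝ) := by rw [hinv, Matrix.mul_one, hFG, Matrix.mul_one]
    rw [hTθ, ← hT]
    simp only [similarity, CK_ofBlocks, BK_ofBlocks, AK_ofBlocks, Matrix.mul_assoc, hinv,
      Matrix.mul_one, and_self]
  refine ⟨H, ?_⟩
  rw [orbitDifferential_apply]
  apply ext_blocks
  · ext i j
    have h1 := hasDerivAt_matrix_mul_apply hC hθ i j
    have h2 := h1.unique ((hconst K.CK i j).congr_of_eventuallyEq
      (hT.mono fun t ht => congrFun₂ ht.1 i j))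
    simp only [hθ0, hγ0, Matrix.mul_one, Matrix.add_apply, Matrix.zero_apply] at h2
    simp only [CK_ofBlocks, Matrix.neg_apply]
    linarith
  · ext i j
    have h1 := hasDerivAt_matrix_mul_apply hθ (hconst K.BK) i j
    have h2 := h1.unique ((hB i j).congr_of_eventuallyEq
      (hT.mono fun t ht => (congrFun₂ ht.2.1 i j).symm))
    simpa using h2
  · ext i j
    have h1 := hasDerivAt_matrix_mul_apply hA hθ i j
    have h2 := h1.unique ((hasDerivAt_matrix_mul_apply hθ (hconst K.AK) i j).congr_of_eventuallyEq
      (hT.mono fun t ht => congrFun₂ ht.2.2 i j))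
    simp only [hθ0, hγ0, Matrix.mul_one, Matrix.add_apply, Matrix.mul_zero, Matrix.zero_apply] at h2
    simp only [AK_ofBlocks, Matrix.sub_apply]
    linarith

theorem orbitTangent_le_range {K : Controller m p q} {F G : Matrix p q ℝ}
    (hFG : K.BK * F + K.AK * K.BK * G = 1) :
    orbitTangent K ≤ LinearMap.range (orbitDifferential K) :=
  Submodule.span_le.2 (tangentVectors_orbit_subset hFG)

end Controller

/-! ## The Hessian at a critical point, and its restriction to the normal space -/

namespace LQGData

open scoped Matrix.Norms.Operator

variable {n m p q : Type} [Fintype n] [Fintype m] [Fintype p] [Fintype q]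
  [DecidableEq n] [DecidableEq m] [DecidableEq p] [DecidableEq q]

/-- The block-diagonal matrix `diag(1, T)`. -/
def stateTransform (n : Type) [DecidableEq n] (T : Matrix q q ℝ) : Matrix (n ⊕ q) (n ⊕ q) ℝ :=
  Matrix.fromBlocks 1 0 0 T

theorem stateTransform_mul (S T : Matrix q q ℝ) :
    stateTransform n S * stateTransform n T = stateTransform n (S * T) := by
  simp [stateTransform, Matrix.fromBlocks_multiply]

theorem stateTransform_mul_inv (T : GL q ℝ) :
    stateTransform n (↑T : Matrix q q ℝ) * stateTransform n (↑T⁻¹ : Matrix q q ℝ) = 1 := by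
  rw [stateTransform_mul, ← Units.val_mul, mul_inv_cancel, Units.val_one, stateTransform,
    Matrix.fromBlocks_one]

theorem stateTransform_inv_mul (T : GL q ℝ) :
    stateTransform n (↑T⁻¹ : Matrix q q ℝ) * stateTransform n (↑T : Matrix q q ℝ) = 1 := by
  rw [stateTransform_mul, ← Units.val_mul, inv_mul_cancel, Units.val_one, stateTransform,
    Matrix.fromBlocks_one]

theorem closedLoop_similarity (D : LQGData n m p) (T : GL q ℝ) (K : Controller m p q) :
    D.closedLoop (Controller.similarity T K) = stateTransform n (↑T : Matrix q q ℝ) *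
      D.closedLoop K * stateTransform n (↑T⁻¹ : Matrix q q ℝ) := by
  simp [closedLoop, stateTransform, Controller.similarity, Matrix.fromBlocks_multiply,
    Matrix.mul_assoc]

theorem noiseIntensity_similarity (D : LQGData n m p) (T : GL q ℝ) (K : Controller m p q) :
    D.noiseIntensity (Controller.similarity T K) = stateTransform n (↑T : Matrix q q ℝ) *
      D.noiseIntensity K * (stateTransform n (↑T : Matrix q q ℝ))ᵀ := by
  simp [noiseIntensity, stateTransform, Controller.similarity, Matrix.fromBlocks_multiply,
    Matrix.fromBlocks_transpose, Matrix.mul_assoc]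

theorem costWeight_similarity (D : LQGData n m p) (T : GL q ℝ) (K : Controller m p q) :
    D.costWeight (Controller.similarity T K) = (stateTransform n (↑T⁻¹ : Matrix q q ℝ))ᵀ *
      D.costWeight K * stateTransform n (↑T⁻¹ : Matrix q q ℝ) := by
  simp [costWeight, stateTransform, Controller.similarity, Matrix.fromBlocks_multiply,
    Matrix.fromBlocks_transpose, Matrix.mul_assoc]

theorem isExpStable_similarity {D : LQGData n m p} (T : GL q ℝ) {K : Controller m p q}
    (hK : (D.closedLoop K).IsExpStable) :
    (D.closedLoop (Controller.similarity T K)).IsExpStable := by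
  have hinv : (stateTransform n (↑T : Matrix q q ℝ))⁻¹ = stateTransform n (↑T⁻¹ : Matrix q q ℝ) :=
    Matrix.inv_eq_right_inv (stateTransform_mul_inv T)
  rw [closedLoop_similarity, ← hinv]
  exact hK.conj ⟨⟨_, _, stateTransform_mul_inv T, stateTransform_inv_mul T⟩, rfl⟩

/-- The LQG cost is invariant under similarity transformations. -/
theorem cost_similarity {D : LQGData n m p} (hW : D.W.PosSemidef) (hV : D.V.PosSemidef)
    (z₀ : EuclideanSpace ℝ (n ⊕ q)) (T : GL q ℝ) {K : Controller m p q}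
    (hK : (D.closedLoop K).IsExpStable) :
    D.cost z₀ (Controller.similarity T K) = D.cost z₀ K := by
  set U := stateTransform n (↑T : Matrix q q ℝ) with hU
  set U' := stateTransform n (↑T⁻¹ : Matrix q q ℝ) with hU'
  have hinv : U' * U = 1 := stateTransform_inv_mul T
  have hinvT : Uᵀ * U'ᵀ = 1 := by rw [← Matrix.transpose_mul, hinv, Matrix.transpose_one]
  have hX := hK.lyapunovSol_spec (D.noiseIntensity K)
  set X := (D.closedLoop K).lyapunovSol (D.noiseIntensity K)
  -- The stationary covariance transforms by congruence with `U = diag(1, T)`.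
  have hX' : D.closedLoop (Controller.similarity T K) * (U * X * Uᵀ) +
      U * X * Uᵀ * (D.closedLoop (Controller.similarity T K))ᵀ +
      D.noiseIntensity (Controller.similarity T K) = 0 := by
    rw [closedLoop_similarity, noiseIntensity_similarity, ← hU, ← hU']
    calc _ = U * D.closedLoop K * (U' * U) * X * Uᵀ +
          U * X * (Uᵀ * U'ᵀ) * (D.closedLoop K)ᵀ * Uᵀ + U * D.noiseIntensity K * Uᵀ := by
            simp only [Matrix.transpose_mul, Matrix.mul_assoc]
      _ = U * (D.closedLoop K * X + X * (D.closedLoop K)ᵀ + D.noiseIntensity K) * Uᵀ := by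
            rw [hinv, hinvT]
            simp only [Matrix.mul_one, Matrix.mul_add, Matrix.add_mul, Matrix.mul_assoc]
      _ = 0 := by rw [hX, Matrix.mul_zero, Matrix.zero_mul]
  rw [cost_eq_trace hW hV z₀ (isExpStable_similarity T hK) hX', cost_eq_trace hW hV z₀ hK hX,
    costWeight_similarity, ← hU']
  calc _ = (U'ᵀ * (D.costWeight K * (U' * U) * X * Uᵀ)).trace := by simp only [Matrix.mul_assoc]
    _ = (D.costWeight K * X * (Uᵀ * U'ᵀ)).trace := by
          rw [hinv, Matrix.mul_one, Matrix.trace_mul_comm, Matrix.mul_assoc]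
    _ = _ := by rw [hinvT, Matrix.mul_one]

variable {D : LQGData n m p} {z₀ : EuclideanSpace ℝ (n ⊕ q)} {K : Controller m p q}

/-- Criticality propagates along orbits. -/
theorem fderiv_cost_similarity (hW : D.W.PosSemidef) (hV : D.V.PosSemidef)
    (hK : ∀ᶠ K' in 𝓝 K, (D.closedLoop K').IsExpStable) (hgrad : fderiv ℝ (D.cost z₀) K = 0)
    (T : GL q ℝ) : fderiv ℝ (D.cost z₀) (Controller.similarity T K) = 0 := by
  let S : Controller m p q →L[ℝ] Controller m p q :=
    LinearMap.toContinuousLinearMap (Controller.similarityLinear T⁻¹)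
  have hS (L : Controller m p q) : S L = Controller.similarity T⁻¹ L := rfl
  have hSK : S (Controller.similarity T K) = K := by
    rw [hS, Controller.similarity_mul, inv_mul_cancel, Controller.similarity_one]
  -- Near the transformed controller the cost equals itself composed with the linear inverse
  -- similarity, so the chain rule carries over the zero gradient.
  have hev : D.cost z₀ =ᶠ[𝓝 (Controller.similarity T K)] D.cost z₀ ∘ S := by
    have htend : Tendsto S (𝓝 (Controller.similarity T K)) (𝓝 K) := by
      simpa [hSK] using S.continuous.tendsto (Controller.similarity T K)
    filter_upwards [htend.eventually hK] with L hL
    have h := cost_similarity hW hV z₀ T hL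
    rwa [hS, Controller.similarity_mul, mul_inv_cancel, Controller.similarity_one] at h
  have hdiff : HasFDerivAt (D.cost z₀) (0 : Controller m p q →L[ℝ] ℝ)
      (S (Controller.similarity T K)) := by
    rw [hSK, ← hgrad]
    exact ((contDiffAt_cost (k := 1) hW hV z₀ hK).differentiableAt (by norm_num)).hasFDerivAt
  rw [hev.fderiv_eq, (hdiff.comp _ S.hasFDerivAt).fderiv, ContinuousLinearMap.zero_comp]

/-- The tangent space of the orbit of a critical point lies in the kernel of the Hessian. -/
theorem hess_orbitTangent_left (hW : D.W.PosSemidef) (hV : D.V.PosSemidef)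
    (hK : ∀ᶠ K' in 𝓝 K, (D.closedLoop K').IsExpStable) (hgrad : fderiv ℝ (D.cost z₀) K = 0)
    {v : Controller m p q} (hv : v ∈ orbitTangent K) (w : Controller m p q) :
    D.hess z₀ K v w = 0 := by
  have hle : orbitTangent K ≤
      LinearMap.ker (fderiv ℝ (fderiv ℝ (D.cost z₀)) K).toLinearMap := by
    refine Submodule.span_le.2 ?_
    rintro u ⟨γ, -, hγ, hγ0, hu⟩
    have hdiff : HasFDerivAt (fderiv ℝ (D.cost z₀)) (fderiv ℝ (fderiv ℝ (D.cost z₀)) K) (γ 0) := by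
      rw [hγ0]
      have h : ContDiffAt ℝ 1 (fderiv ℝ (D.cost z₀)) K :=
        (contDiffAt_cost (k := 2) hW hV z₀ hK).fderiv_right (by norm_num)
      exact (h.differentiableAt (by norm_num)).hasFDerivAt
    have h1 := hdiff.comp_hasDerivAt (0 : ℝ) hu
    -- Every point of the curve lies on the orbit, where the gradient vanishes; differentiating at
    -- `0` gives the Hessian applied to the velocity.
    have hzero : (fderiv ℝ (D.cost z₀) ∘ γ) =ᶠ[𝓝 0] fun _ => 0 := by
      filter_upwards [Ioo_mem_nhds (by norm_num : (-1 : ℝ) < 0) (by norm_num : (0 : ℝ) < 1)]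
        with t ht
      obtain ⟨T, hT⟩ := hγ t ht
      rw [Function.comp_apply, ← hT]
      exact fderiv_cost_similarity hW hV hK hgrad T
    exact h1.unique ((hasDerivAt_const (0 : ℝ) _).congr_of_eventuallyEq hzero)
  exact congrArg (fun L : Controller m p q →L[ℝ] ℝ => L w) (LinearMap.mem_ker.1 (hle hv))

theorem hess_comm (hW : D.W.PosSemidef) (hV : D.V.PosSemidef)
    (hK : ∀ᶠ K' in 𝓝 K, (D.closedLoop K').IsExpStable) (v w : Controller m p q) :
    D.hess z₀ K v w = D.hess z₀ K w v :=
  (contDiffAt_cost (k := 2) hW hV z₀ hK).isSymmSndFDerivAt (by simp) v w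

/-- The Hessian at a critical point only sees the component normal to the orbit. -/
theorem hess_sub_orbitTangent (hW : D.W.PosSemidef) (hV : D.V.PosSemidef)
    (hK : ∀ᶠ K' in 𝓝 K, (D.closedLoop K').IsExpStable) (hgrad : fderiv ℝ (D.cost z₀) K = 0)
    {v : Controller m p q} (hv : v ∈ orbitTangent K) (w : Controller m p q) :
    D.hess z₀ K (w - v) (w - v) = D.hess z₀ K w w := by
  have h1 := hess_orbitTangent_left hW hV hK hgrad hv
  have h2 := hess_comm hW hV hK (z₀ := z₀) w v
  have h3 : D.hess z₀ K (w - v) (w - v) = D.hess z₀ K w w - D.hess z₀ K v w -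
      (D.hess z₀ K w v - D.hess z₀ K v v) := by
    simp only [hess, map_sub, sub_apply]
  rw [h3, h2, h1, h1]
  ring

/-- If the orbit has a nontrivial normal space, the restricted Rayleigh quotients form a nonempty
compact set. -/
theorem normalRayleigh_compact {Δ : Controller m p q} (hΔ : Δ ∉ orbitTangent K) :
    IsCompact (D.normalRayleigh z₀ K) ∧ (D.normalRayleigh z₀ K).Nonempty := by
  have hmem : Δ - (orbitTangent K).starProjection Δ ∈ (orbitTangent K)ᗮ :=
    Submodule.sub_starProjection_mem_orthogonal Δ
  refine ⟨?_, _, _, hmem, fun h => hΔ ?_, rfl⟩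
  -- By homogeneity unit vectors suffice, and the unit sphere of the normal space is compact.
  · have himage : D.normalRayleigh z₀ K = (fun v => D.hess z₀ K v v) ''
        (Metric.sphere 0 1 ∩ ((orbitTangent K)ᗮ : Set (Controller m p q))) := by
      ext r
      constructor
      · rintro ⟨v, hv, hv0, rfl⟩
        have hn : ‖v‖ ≠ 0 := norm_ne_zero_iff.2 hv0
        refine ⟨‖v‖⁻¹ • v, ⟨by simp [norm_smul, hn], Submodule.smul_mem _ _ hv⟩, ?_⟩
        simp only [hess, map_smul, smul_apply, smul_eq_mul]
        field_simp
      · rintro ⟨v, ⟨hv1, hv⟩, rfl⟩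
        have hn : ‖v‖ = 1 := by simpa using hv1
        exact ⟨v, hv, by rintro rfl; simp at hn, by simp [hn]⟩
    rw [himage]
    refine IsCompact.image ((isCompact_sphere 0 1).inter_right
      (Submodule.isClosed_orthogonal _)) ?_
    unfold hess
    fun_prop
  · rw [sub_eq_zero.1 h]
    exact Submodule.starProjection_apply_mem _ _

/-- The Rayleigh quotient of the normal component of a direction. -/
theorem rayleigh_mem_normalRayleigh (hW : D.W.PosSemidef) (hV : D.V.PosSemidef)
    (hK : ∀ᶠ K' in 𝓝 K, (D.closedLoop K').IsExpStable) (hgrad : fderiv ℝ (D.cost z₀) K = 0)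
    {Δ : Controller m p q} (hΔ : Δ ∉ orbitTangent K) :
    0 < ‖Δ‖ ^ 2 - ‖(orbitTangent K).starProjection Δ‖ ^ 2 ∧
    D.hess z₀ K Δ Δ / (‖Δ‖ ^ 2 - ‖(orbitTangent K).starProjection Δ‖ ^ 2) ∈
      D.normalRayleigh z₀ K := by
  have hmem : Δ - (orbitTangent K).starProjection Δ ∈ (orbitTangent K)ᗮ :=
    Submodule.sub_starProjection_mem_orthogonal Δ
  have hproj : (orbitTangent K).starProjection Δ ∈ orbitTangent K :=
    Submodule.starProjection_apply_mem _ _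
  have hne : Δ - (orbitTangent K).starProjection Δ ≠ 0 := fun h => hΔ (by
    rw [sub_eq_zero.1 h]
    exact hproj)
  have hnorm : ‖Δ - (orbitTangent K).starProjection Δ‖ ^ 2 =
      ‖Δ‖ ^ 2 - ‖(orbitTangent K).starProjection Δ‖ ^ 2 := by
    have h := norm_add_sq_eq_norm_sq_add_norm_sq_real
      (Submodule.inner_right_of_mem_orthogonal hproj hmem)
    rw [add_sub_cancel] at h
    linarith
  refine ⟨hnorm ▸ by positivity, _, hmem, hne, ?_⟩
  rw [hnorm, hess_sub_orbitTangent hW hV hK hgrad hproj]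

end LQGData

/-! ## The example: explicit Lyapunov solutions -/

noncomputable section

/-- The stationary covariance of the closed loop with the optimal controller. -/
def exampleCov (ε : ℝ) : Matrix (Fin 2 ⊕ Fin 2) (Fin 2 ⊕ Fin 2) ℝ :=
  (35 * (2 + ε))⁻¹ • Matrix.fromBlocks
    !![80 + 38 * ε, 10 + 10 * ε;
      10 + 10 * ε, 80 + 122 * ε + 42 * ε ^ 2]
    !![10 + 3 * ε, 10 + 10 * ε;
      10 + 10 * ε, 10 + 17 * ε + 7 * ε ^ 2]
    !![10 + 3 * ε, 10 + 10 * ε;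
      10 + 10 * ε, 10 + 17 * ε + 7 * ε ^ 2]
    !![10 + 3 * ε, 10 + 10 * ε;
      10 + 10 * ε, 10 + 17 * ε + 7 * ε ^ 2]

/-- The solution of the dual Lyapunov equation at the optimal controller. -/
def exampleDual (ε : ℝ) : Matrix (Fin 2 ⊕ Fin 2) (Fin 2 ⊕ Fin 2) ℝ :=
  (35 * ((2 + ε) * (1 + ε)))⁻¹ • Matrix.fromBlocks
    !![80 + 118 * ε + 38 * ε ^ 2, 10 + 10 * ε;
      10 + 10 * ε, 80 + 42 * ε]
    !![-10 - 13 * ε - 3 * ε ^ 2, -10 - 10 * ε;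
      -10 - 10 * ε, -10 - 7 * ε]
    !![-10 - 13 * ε - 3 * ε ^ 2, -10 - 10 * ε;
      -10 - 10 * ε, -10 - 7 * ε]
    !![10 + 13 * ε + 3 * ε ^ 2, 10 + 10 * ε;
      10 + 10 * ε, 10 + 7 * ε]

/-- The derivative of the stationary covariance in the direction `Δ₀`. -/
def exampleCovDir₀ (ε : ℝ) : Matrix (Fin 2 ⊕ Fin 2) (Fin 2 ⊕ Fin 2) ℝ :=
  (2450 * (2 + ε) ^ 2)⁻¹ • Matrix.fromBlocks
    !![-6 * ε ^ 2, -6 * ε ^ 2;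
      -6 * ε ^ 2, -6 * ε ^ 2]
    !![98 * ε + 29 * ε ^ 2, -98 * ε - 20 * ε ^ 2;
      98 * ε + 78 * ε ^ 2, -98 * ε - 69 * ε ^ 2]
    !![98 * ε + 29 * ε ^ 2, 98 * ε + 78 * ε ^ 2;
      -98 * ε - 20 * ε ^ 2, -98 * ε - 69 * ε ^ 2]
    !![196 * ε + 64 * ε ^ 2, 64 * ε ^ 2;
      64 * ε ^ 2, -196 * ε - 132 * ε ^ 2]

/-- The derivative of the stationary covariance in the direction `Δ₁`. -/
def exampleCovDir₁ (ε : ℝ) : Matrix (Fin 2 ⊕ Fin 2) (Fin 2 ⊕ Fin 2) ℝ :=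
  (85750 * (2 + ε) ^ 3)⁻¹ • Matrix.fromBlocks
    !![-72000 - 95424 * ε - 43608 * ε ^ 2 - 6864 * ε ^ 3, -72000 - 126000 * ε - 66540 * ε ^ 2 - 10980 * ε ^ 3;
      -72000 - 126000 * ε - 66540 * ε ^ 2 - 10980 * ε ^ 3, -72000 - 156576 * ε - 120048 * ε ^ 2 - 38028 * ε ^ 3 - 4116 * ε ^ 4]
    !![5000 + 23156 * ε + 18202 * ε ^ 2 + 4021 * ε ^ 3, 5000 - 41720 * ε - 40990 * ε ^ 2 - 9650 * ε ^ 3;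
      5000 + 34720 * ε + 32510 * ε ^ 2 + 7990 * ε ^ 3, 5000 - 30156 * ε - 43538 * ε ^ 2 - 18323 * ε ^ 3 - 2401 * ε ^ 4]
    !![5000 + 23156 * ε + 18202 * ε ^ 2 + 4021 * ε ^ 3, 5000 + 34720 * ε + 32510 * ε ^ 2 + 7990 * ε ^ 3;
      5000 - 41720 * ε - 40990 * ε ^ 2 - 9650 * ε ^ 3, 5000 - 30156 * ε - 43538 * ε ^ 2 - 18323 * ε ^ 3 - 2401 * ε ^ 4]
    !![82000 + 141736 * ε + 80012 * ε ^ 2 + 14906 * ε ^ 3, 82000 + 119000 * ε + 58060 * ε ^ 2 + 9320 * ε ^ 3;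
      82000 + 119000 * ε + 58060 * ε ^ 2 + 9320 * ε ^ 3, 82000 + 96264 * ε + 32972 * ε ^ 2 + 1382 * ε ^ 3 - 686 * ε ^ 4]

theorem closedLoop_exampleK {ε : ℝ} (hε : 0 < ε) :
    (examplePlant ε).closedLoop (exampleK ε) = Matrix.fromBlocks
      !![-3 / 2, 0; 0, -3 / 2 * (1 + ε)] !![-1, -1; -(1 + ε), -(1 + ε)]
      !![1, 1; 1 + ε, 1 + ε] !![-7 / 2, -2; -2 * (1 + ε), -7 / 2 * (1 + ε)] := by
  rw [exampleK_eq ε hε]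
  simp only [LQGData.closedLoop, Controller.CK_ofBlocks, Controller.BK_ofBlocks,
    Controller.AK_ofBlocks, examplePlant]
  congr 1 <;> ext i j <;> fin_cases i <;> fin_cases j <;> simp [Matrix.mul_apply] <;> ring

theorem noiseIntensity_exampleK {ε : ℝ} (hε : 0 < ε) :
    (examplePlant ε).noiseIntensity (exampleK ε) = Matrix.fromBlocks
      !![4, 1 + ε; 1 + ε, 4 * (1 + ε) ^ 2] 0 0 !![1, 1 + ε; 1 + ε, (1 + ε) ^ 2] := by
  rw [exampleK_eq ε hε]
  simp only [LQGData.noiseIntensity, Controller.BK_ofBlocks, examplePlant]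
  congr 1
  ext i j
  fin_cases i <;> fin_cases j <;> simp [Matrix.mul_apply] <;> ring

theorem costWeight_exampleK {ε : ℝ} (hε : 0 < ε) :
    (examplePlant ε).costWeight (exampleK ε) = Matrix.fromBlocks
      !![4, 1; 1, 4] 0 0 !![1, 1; 1, 1] := by
  rw [exampleK_eq ε hε]
  simp only [LQGData.costWeight, Controller.CK_ofBlocks, examplePlant]
  congr 1
  ext i j
  fin_cases i <;> fin_cases j <;> simp [Matrix.mul_apply]

/-- The candidate has the shape `[P + Ξ, Ξ; Ξ, Ξ]` with `P` the filter Riccati solution: the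
estimation error `x - ξ` has covariance `P` and is uncorrelated with `ξ`. -/
theorem exampleCov_lyapunov {ε : ℝ} (hε : 0 < ε) :
    (examplePlant ε).closedLoop (exampleK ε) * exampleCov ε +
      exampleCov ε * ((examplePlant ε).closedLoop (exampleK ε))ᵀ +
      (examplePlant ε).noiseIntensity (exampleK ε) = 0 := by
  have h2 : 2 + ε ≠ 0 := by positivity
  rw [closedLoop_exampleK hε, noiseIntensity_exampleK hε, exampleCov, Matrix.mul_smul,
    Matrix.smul_mul, ← smul_add, Matrix.fromBlocks_transpose, Matrix.fromBlocks_multiply,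
    Matrix.fromBlocks_multiply, Matrix.fromBlocks_add, Matrix.fromBlocks_smul,
    Matrix.fromBlocks_add, ← Matrix.fromBlocks_zero]
  congr 1 <;> ext i j <;> fin_cases i <;> fin_cases j <;> 
    simp [Matrix.mul_apply, Matrix.vecMul, dotProduct, Matrix.vecHead, Matrix.vecTail,
      -mul_eq_zero] <;>
    field_simp <;> ring

/-- Dually, the candidate is `[S + Λ, -Λ; -Λ, Λ]` with `S` the control Riccati solution. -/
theorem exampleDual_lyapunov {ε : ℝ} (hε : 0 < ε) :
    ((examplePlant ε).closedLoop (exampleK ε))ᵀ * exampleDual ε +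
      exampleDual ε * (examplePlant ε).closedLoop (exampleK ε) +
      (examplePlant ε).costWeight (exampleK ε) = 0 := by
  have h2 : 2 + ε ≠ 0 := by positivity
  have h1 : 1 + ε ≠ 0 := by positivity
  rw [closedLoop_exampleK hε, costWeight_exampleK hε, exampleDual, Matrix.mul_smul,
    Matrix.smul_mul, ← smul_add, Matrix.fromBlocks_transpose, Matrix.fromBlocks_multiply,
    Matrix.fromBlocks_multiply, Matrix.fromBlocks_add, Matrix.fromBlocks_smul,
    Matrix.fromBlocks_add, ← Matrix.fromBlocks_zero]
  congr 1 <;> ext i j <;> fin_cases i <;> fin_cases j <;> 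
    simp [Matrix.mul_apply, Matrix.vecMul, dotProduct, Matrix.vecHead, Matrix.vecTail,
      -mul_eq_zero] <;>
    field_simp <;> ring

end

/-! ## The example: gradient and Hessian -/

noncomputable section

theorem Matrix.trace_fromBlocks_add {a b : Type*} [Fintype a] [Fintype b] (A : Matrix a a ℝ)
    (B : Matrix a b ℝ) (C : Matrix b a ℝ) (D : Matrix b b ℝ) :
    (Matrix.fromBlocks A B C D).trace = A.trace + D.trace := by
  simp [Matrix.trace, Fintype.sum_sum_type]

/-! ### First- and second-order increments of the closed-loop data in an arbitrary direction -/

section Directions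

variable (ε c₀ c₁ b₀ b₁ a d e f : ℝ)

theorem closedLoopDir_examplePlant :
    (examplePlant ε).closedLoopDir (Controller.ofBlocks !![c₀, c₁] !![b₀; b₁] !![a, d; e, f]) =
      Matrix.fromBlocks 0 !![c₀, c₁; (1 + ε) * c₀, (1 + ε) * c₁] !![b₀, b₀; b₁, b₁]
        !![a, d; e, f] := by
  simp only [LQGData.closedLoopDir, Controller.CK_ofBlocks, Controller.BK_ofBlocks,
    Controller.AK_ofBlocks, examplePlant]
  congr 1 <;> ext i j <;> fin_cases i <;> fin_cases j <;> simp [Matrix.mul_apply]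

theorem noiseDir_exampleK {ε : ℝ} (hε : 0 < ε) : (examplePlant ε).noiseDir (exampleK ε)
      (Controller.ofBlocks !![c₀, c₁] !![b₀; b₁] !![a, d; e, f]) =
    Matrix.fromBlocks 0 0 0 !![2 * b₀, b₁ + (1 + ε) * b₀; b₁ + (1 + ε) * b₀,
      2 * (1 + ε) * b₁] := by
  rw [exampleK_eq ε hε]
  simp only [LQGData.noiseDir, Controller.BK_ofBlocks, examplePlant]
  congr 1
  ext i j
  fin_cases i <;> fin_cases j <;> 
    simp [Matrix.mul_apply, Matrix.vecMul, dotProduct, Matrix.vecHead, Matrix.vecTail] <;> ring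

theorem noiseQuad_examplePlant :
    (examplePlant ε).noiseQuad (Controller.ofBlocks !![c₀, c₁] !![b₀; b₁] !![a, d; e, f]) =
    Matrix.fromBlocks 0 0 0 !![b₀ * b₀, b₀ * b₁; b₁ * b₀, b₁ * b₁] := by
  simp only [LQGData.noiseQuad, Controller.BK_ofBlocks, examplePlant]
  congr 1
  ext i j
  fin_cases i <;> fin_cases j <;> simp [Matrix.mul_apply]

theorem weightDir_exampleK {ε : ℝ} (hε : 0 < ε) : (examplePlant ε).weightDir (exampleK ε)
      (Controller.ofBlocks !![c₀, c₁] !![b₀; b₁] !![a, d; e, f]) =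
    Matrix.fromBlocks 0 0 0 !![-(2 * c₀), -(c₀ + c₁); -(c₀ + c₁), -(2 * c₁)] := by
  rw [exampleK_eq ε hε]
  simp only [LQGData.weightDir, Controller.CK_ofBlocks, examplePlant]
  congr 1
  ext i j
  fin_cases i <;> fin_cases j <;> 
    simp [Matrix.mul_apply, Matrix.vecMul, dotProduct, Matrix.vecHead, Matrix.vecTail] <;> ring

theorem weightQuad_examplePlant :
    (examplePlant ε).weightQuad (Controller.ofBlocks !![c₀, c₁] !![b₀; b₁] !![a, d; e, f]) =
    Matrix.fromBlocks 0 0 0 !![c₀ * c₀, c₀ * c₁; c₁ * c₀, c₁ * c₁] := by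
  simp only [LQGData.weightQuad, Controller.CK_ofBlocks, examplePlant]
  congr 1
  ext i j
  fin_cases i <;> fin_cases j <;> simp [Matrix.mul_apply]

end Directions

theorem Controller.exists_eq_ofBlocks (Δ : Controller (Fin 1) (Fin 1) (Fin 2)) :
    ∃ c₀ c₁ b₀ b₁ a d e f : ℝ,
      Δ = Controller.ofBlocks !![c₀, c₁] !![b₀; b₁] !![a, d; e, f] := by
  refine ⟨Δ.CK 0 0, Δ.CK 0 1, Δ.BK 0 0, Δ.BK 1 0, Δ.AK 0 0, Δ.AK 0 1, Δ.AK 1 0, Δ.AK 1 1, ?_⟩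
  apply Controller.ext_blocks <;> ext i j <;> fin_cases i <;> fin_cases j <;> rfl

/-- First-order stationarity of the optimal controller in terms of Lyapunov solutions. -/
theorem example_gradient_trace {ε : ℝ} (hε : 0 < ε) (Δ : Controller (Fin 1) (Fin 1) (Fin 2)) :
    (exampleDual ε * (examplePlant ε).noiseDir (exampleK ε) Δ).trace +
      (((examplePlant ε).weightDir (exampleK ε) Δ +
        exampleDual ε * (examplePlant ε).closedLoopDir Δ +
        ((examplePlant ε).closedLoopDir Δ)ᵀ * exampleDual ε) * exampleCov ε).trace = 0 := by
  have h2 : 2 + ε ≠ 0 := by positivity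
  have h1 : 1 + ε ≠ 0 := by positivity
  obtain ⟨c₀, c₁, b₀, b₁, a, d, e, f, rfl⟩ := Δ.exists_eq_ofBlocks
  rw [closedLoopDir_examplePlant, noiseDir_exampleK _ _ _ _ _ _ _ _ hε,
    weightDir_exampleK _ _ _ _ _ _ _ _ hε, exampleDual, exampleCov]
  simp only [Matrix.smul_mul, Matrix.mul_smul, Matrix.add_mul, Matrix.fromBlocks_transpose,
    Matrix.fromBlocks_multiply, Matrix.trace_add, Matrix.trace_smul, Matrix.trace_fromBlocks_add,
    Matrix.trace_fin_two, Matrix.transpose_zero, Matrix.zero_mul, Matrix.mul_zero,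
    Matrix.trace_zero]
  simp [Matrix.mul_apply, Matrix.vecMul, dotProduct, Matrix.vecHead, Matrix.vecTail,
      -mul_eq_zero]
  field_simp
  ring

theorem exampleCovDir₀_lyapunov {ε : ℝ} (hε : 0 < ε) :
    (examplePlant ε).closedLoop (exampleK ε) * exampleCovDir₀ ε +
      exampleCovDir₀ ε * ((examplePlant ε).closedLoop (exampleK ε))ᵀ +
      ((examplePlant ε).closedLoopDir exampleΔ₀ * exampleCov ε +
        exampleCov ε * ((examplePlant ε).closedLoopDir exampleΔ₀)ᵀ +
        (examplePlant ε).noiseDir (exampleK ε) exampleΔ₀) = 0 := by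
  have h2 : 2 + ε ≠ 0 := by positivity
  rw [closedLoop_exampleK hε, exampleΔ₀, closedLoopDir_examplePlant,
    noiseDir_exampleK _ _ _ _ _ _ _ _ hε, exampleCov, exampleCovDir₀]
  simp only [Matrix.smul_mul, Matrix.mul_smul, Matrix.fromBlocks_transpose,
    Matrix.fromBlocks_multiply, Matrix.fromBlocks_add, Matrix.fromBlocks_smul]
  rw [← Matrix.fromBlocks_zero]
  congr 1 <;> ext i j <;> fin_cases i <;> fin_cases j <;>
    simp [Matrix.mul_apply, Matrix.vecMul, dotProduct, Matrix.vecHead, Matrix.vecTail,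
      -mul_eq_zero] <;>
    field_simp <;> ring

set_option maxHeartbeats 1000000 in
theorem exampleCovDir₁_lyapunov {ε : ℝ} (hε : 0 < ε) :
    (examplePlant ε).closedLoop (exampleK ε) * exampleCovDir₁ ε +
      exampleCovDir₁ ε * ((examplePlant ε).closedLoop (exampleK ε))ᵀ +
      ((examplePlant ε).closedLoopDir exampleΔ₁ * exampleCov ε +
        exampleCov ε * ((examplePlant ε).closedLoopDir exampleΔ₁)ᵀ +
        (examplePlant ε).noiseDir (exampleK ε) exampleΔ₁) = 0 := by
  have h2 : 2 + ε ≠ 0 := by positivity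
  rw [closedLoop_exampleK hε, exampleΔ₁, closedLoopDir_examplePlant,
    noiseDir_exampleK _ _ _ _ _ _ _ _ hε, exampleCov, exampleCovDir₁]
  simp only [Matrix.smul_mul, Matrix.mul_smul, Matrix.fromBlocks_transpose,
    Matrix.fromBlocks_multiply, Matrix.fromBlocks_add, Matrix.fromBlocks_smul]
  rw [← Matrix.fromBlocks_zero]
  congr 1 <;> ext i j <;> fin_cases i <;> fin_cases j <;>
    simp [Matrix.mul_apply, Matrix.vecMul, dotProduct, Matrix.vecHead, Matrix.vecTail,
      -mul_eq_zero] <;>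
    field_simp <;> ring

/-- As `Δ₀` changes only `A_K`, the increments of noise and weight vanish; the orders below `ε⁴`
cancel in what is left. -/
theorem example_hessian_trace₀ {ε : ℝ} (hε : 0 < ε) :
    2 * (exampleDual ε * (examplePlant ε).noiseQuad exampleΔ₀).trace +
      2 * (((examplePlant ε).weightQuad exampleΔ₀ * exampleCov ε).trace +
      (((examplePlant ε).weightDir (exampleK ε) exampleΔ₀ +
        exampleDual ε * (examplePlant ε).closedLoopDir exampleΔ₀ +
        ((examplePlant ε).closedLoopDir exampleΔ₀)ᵀ * exampleDual ε) *
        exampleCovDir₀ ε).trace) = 3 * ε ^ 4 / (875 * ((2 + ε) ^ 3 * (1 + ε))) := by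
  have h2 : 2 + ε ≠ 0 := by positivity
  have h1 : 1 + ε ≠ 0 := by positivity
  rw [exampleΔ₀, closedLoopDir_examplePlant, noiseQuad_examplePlant, weightQuad_examplePlant,
    weightDir_exampleK _ _ _ _ _ _ _ _ hε, exampleDual, exampleCov, exampleCovDir₀]
  simp only [Matrix.smul_mul, Matrix.mul_smul, Matrix.add_mul, Matrix.fromBlocks_transpose,
    Matrix.fromBlocks_multiply, Matrix.trace_add, Matrix.trace_smul, Matrix.trace_fromBlocks_add,
    Matrix.trace_fin_two, Matrix.transpose_zero, Matrix.zero_mul, Matrix.mul_zero,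
    Matrix.trace_zero]
  simp [Matrix.mul_apply, Matrix.vecMul, dotProduct, Matrix.vecHead, Matrix.vecTail,
      -mul_eq_zero]
  field_simp
  ring

theorem example_hessian_trace₁ {ε : ℝ} (hε : 0 < ε) :
    2 * (exampleDual ε * (examplePlant ε).noiseQuad exampleΔ₁).trace +
      2 * (((examplePlant ε).weightQuad exampleΔ₁ * exampleCov ε).trace +
      (((examplePlant ε).weightDir (exampleK ε) exampleΔ₁ +
        exampleDual ε * (examplePlant ε).closedLoopDir exampleΔ₁ +
        ((examplePlant ε).closedLoopDir exampleΔ₁)ᵀ * exampleDual ε) *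
        exampleCovDir₁ ε).trace) =
      (1360000 + 3400000 * ε + 3138280 * ε ^ 2 + 1316860 * ε ^ 3 + 239410 * ε ^ 4 +
        12691 * ε ^ 5) / (85750 * ((2 + ε) ^ 3 * (1 + ε))) := by
  have h2 : 2 + ε ≠ 0 := by positivity
  have h1 : 1 + ε ≠ 0 := by positivity
  rw [exampleΔ₁, closedLoopDir_examplePlant, noiseQuad_examplePlant, weightQuad_examplePlant,
    weightDir_exampleK _ _ _ _ _ _ _ _ hε, exampleDual, exampleCov, exampleCovDir₁]
  simp only [Matrix.smul_mul, Matrix.mul_smul, Matrix.add_mul, Matrix.fromBlocks_transpose,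
    Matrix.fromBlocks_multiply, Matrix.trace_add, Matrix.trace_smul, Matrix.trace_fromBlocks_add,
    Matrix.trace_fin_two, Matrix.transpose_zero, Matrix.zero_mul, Matrix.mul_zero,
    Matrix.trace_zero]
  simp [Matrix.mul_apply, Matrix.vecMul, dotProduct, Matrix.vecHead, Matrix.vecTail,
      -mul_eq_zero]
  field_simp
  ring

end

/-! ## The example: stability, tangent space and projection -/

noncomputable section

/-- A Lyapunov matrix of the closed loop with the optimal controller. -/
def exampleLyapunov (ε : ℝ) : Matrix (Fin 2 ⊕ Fin 2) (Fin 2 ⊕ Fin 2) ℝ :=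
  Matrix.fromBlocks !![1 + ε, 0; 0, 1] !![-(1 + ε), 0; 0, -1]
    !![-(1 + ε), 0; 0, -1] !![2 * (1 + ε), 0; 0, 2]

/-- The form is the squared length of `x - ξ` plus that of `ξ`, both weighted by `diag(1 + ε, 1)`.
-/
theorem exampleLyapunov_posDef {ε : ℝ} (hε : 0 < ε) : (exampleLyapunov ε).PosDef := by
  refine .of_dotProduct_mulVec_pos ?_ fun v hv => ?_
  · ext i j
    rcases i with i | i <;> rcases j with j | j <;> fin_cases i <;> fin_cases j <;>
      simp [exampleLyapunov]
  · obtain ⟨a, b, rfl⟩ : ∃ a b, v = Sum.elim a b := ⟨_, _, (Sum.elim_comp_inl_inr v).symm⟩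
    rw [star_trivial, exampleLyapunov, Matrix.fromBlocks_mulVec, sumElim_dotProduct_sumElim]
    have heq : a ⬝ᵥ (!![1 + ε, 0; 0, 1] *ᵥ a + !![-(1 + ε), 0; 0, -1] *ᵥ b) +
        b ⬝ᵥ (!![-(1 + ε), 0; 0, -1] *ᵥ a + !![2 * (1 + ε), 0; 0, 2] *ᵥ b) =
        (1 + ε) * ((a 0 - b 0) ^ 2 + b 0 ^ 2) + ((a 1 - b 1) ^ 2 + b 1 ^ 2) := by
      simp [Matrix.mulVec, dotProduct, Fin.sum_univ_two]
      ring
    rw [Sum.elim_comp_inl, Sum.elim_comp_inr, heq]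
    by_contra! hle
    have hε1 : 0 < 1 + ε := by positivity
    have h0 : (a 0 - b 0) ^ 2 + b 0 ^ 2 = 0 := by
      nlinarith [sq_nonneg (a 0 - b 0), sq_nonneg (b 0), sq_nonneg (a 1 - b 1), sq_nonneg (b 1)]
    have h1 : (a 1 - b 1) ^ 2 + b 1 ^ 2 = 0 := by
      nlinarith [sq_nonneg (a 1 - b 1), sq_nonneg (b 1)]
    have hb0 : b 0 = 0 := by nlinarith [sq_nonneg (a 0 - b 0), sq_nonneg (b 0)]
    have hb1 : b 1 = 0 := by nlinarith [sq_nonneg (a 1 - b 1), sq_nonneg (b 1)]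
    have ha0 : a 0 = 0 := by simpa [hb0] using h0
    have ha1 : a 1 = 0 := by simpa [hb1] using h1
    refine hv (funext fun i => ?_)
    rcases i with i | i <;> fin_cases i <;> simp [ha0, ha1, hb0, hb1]

theorem exampleLyapunov_isHermitian (ε : ℝ) (M : Matrix (Fin 2 ⊕ Fin 2) (Fin 2 ⊕ Fin 2) ℝ) :
    (-(Mᵀ * exampleLyapunov ε + exampleLyapunov ε * M)).IsHermitian := by
  have hsymm : (exampleLyapunov ε)ᵀ = exampleLyapunov ε := by
    ext i j
    rcases i with i | i <;> rcases j with j | j <;> fin_cases i <;> fin_cases j <;>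
      simp [exampleLyapunov]
  rw [Matrix.IsHermitian, Matrix.conjTranspose_eq_transpose_of_trivial, Matrix.transpose_neg,
    Matrix.transpose_add, Matrix.transpose_mul, Matrix.transpose_mul, hsymm,
    Matrix.transpose_transpose, add_comm]

/-- The second row of each closed-loop block carries a factor `1 + ε`, which the weight `diag(1 + ε,
1)` balances: the decrease is `1 + ε` times a constant matrix. -/
theorem exampleLyapunov_decrease_posDef {ε : ℝ} (hε : 0 < ε) :
    (-(((examplePlant ε).closedLoop (exampleK ε))ᵀ * exampleLyapunov ε +
      exampleLyapunov ε * (examplePlant ε).closedLoop (exampleK ε))).PosDef := by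
  refine .of_dotProduct_mulVec_pos (exampleLyapunov_isHermitian ε _) fun v hv => ?_
  have hmat : -(((examplePlant ε).closedLoop (exampleK ε))ᵀ * exampleLyapunov ε +
      exampleLyapunov ε * (examplePlant ε).closedLoop (exampleK ε)) = (1 + ε) •
      Matrix.fromBlocks !![5, 2; 2, 5] !![-6, -3; -3, -6] !![-6, -3; -3, -6]
        !![12, 6; 6, 12] := by
    rw [closedLoop_exampleK hε, exampleLyapunov, Matrix.fromBlocks_transpose,
      Matrix.fromBlocks_multiply, Matrix.fromBlocks_multiply, Matrix.fromBlocks_add,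
      Matrix.fromBlocks_neg, Matrix.fromBlocks_smul]
    congr 1 <;> ext i j <;> fin_cases i <;> fin_cases j <;>
      simp [Matrix.mul_apply, Matrix.vecMul, dotProduct, Matrix.vecHead, Matrix.vecTail] <;> ring
  obtain ⟨a, b, rfl⟩ : ∃ a b, v = Sum.elim a b := ⟨_, _, (Sum.elim_comp_inl_inr v).symm⟩
  -- Passing to sums and differences of the two coordinates decouples the form into squares.
  have heq : a ⬝ᵥ (!![5, 2; 2, 5] *ᵥ a + !![-6, -3; -3, -6] *ᵥ b) +
      b ⬝ᵥ (!![-6, -3; -3, -6] *ᵥ a + !![12, 6; 6, 12] *ᵥ b) =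
      (a 0 + a 1 - 2 * (b 0 + b 1)) ^ 2 + 5 / 2 * (a 0 - b 0 + (a 1 - b 1)) ^ 2 +
        5 / 2 * (b 0 + b 1) ^ 2 + 3 / 2 * (a 0 - b 0 - (a 1 - b 1)) ^ 2 +
        3 / 2 * (b 0 - b 1) ^ 2 := by
    simp [Matrix.mulVec, dotProduct, Fin.sum_univ_two]
    ring
  rw [star_trivial, hmat, Matrix.smul_mulVec, dotProduct_smul, Matrix.fromBlocks_mulVec,
    sumElim_dotProduct_sumElim, Sum.elim_comp_inl, Sum.elim_comp_inr, heq]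
  refine smul_pos (by positivity) ?_
  by_contra! hle
  set p := a 0 - b 0 + (a 1 - b 1)
  set r := a 0 - b 0 - (a 1 - b 1)
  have hs := sq_nonneg (a 0 + a 1 - 2 * (b 0 + b 1))
  have hp : p = 0 := by nlinarith [sq_nonneg p, sq_nonneg r, sq_nonneg (b 0 + b 1), sq_nonneg (b 0 - b 1)]
  have hr : r = 0 := by nlinarith [sq_nonneg p, sq_nonneg r, sq_nonneg (b 0 + b 1), sq_nonneg (b 0 - b 1)]
  have hb : b 0 + b 1 = 0 := by
    nlinarith [sq_nonneg p, sq_nonneg r, sq_nonneg (b 0 + b 1), sq_nonneg (b 0 - b 1)]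
  have hb' : b 0 - b 1 = 0 := by
    nlinarith [sq_nonneg p, sq_nonneg r, sq_nonneg (b 0 + b 1), sq_nonneg (b 0 - b 1)]
  have hb0 : b 0 = 0 := by linarith
  have hb1 : b 1 = 0 := by linarith
  have ha0 : a 0 = 0 := by simp only [p, r] at hp hr; linarith
  have ha1 : a 1 = 0 := by simp only [p, r] at hp hr; linarith
  refine hv (funext fun i => ?_)
  rcases i with i | i <;> fin_cases i <;> simp [ha0, ha1, hb0, hb1]

theorem example_eventually_lyapunov {ε : ℝ} (hε : 0 < ε) : ∀ᶠ K in 𝓝 (exampleK ε),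
    (-(((examplePlant ε).closedLoop K)ᵀ * exampleLyapunov ε +
      exampleLyapunov ε * (examplePlant ε).closedLoop K)).PosDef := by
  have hcont : Continuous ((examplePlant ε).closedLoop :
      Controller (Fin 1) (Fin 1) (Fin 2) → Matrix (Fin 2 ⊕ Fin 2) (Fin 2 ⊕ Fin 2) ℝ) :=
    (examplePlant ε).continuous_closedLoop
  exact Matrix.PosDef.eventually_posDef
    (((hcont.matrix_transpose.matrix_mul continuous_const).add
      (continuous_const.matrix_mul hcont)).neg)
    (fun K => exampleLyapunov_isHermitian ε _) (exampleLyapunov_decrease_posDef hε)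

theorem example_eventually_isExpStable {ε : ℝ} (hε : 0 < ε) : ∀ᶠ K in 𝓝 (exampleK ε),
    ((examplePlant ε).closedLoop K).IsExpStable :=
  (example_eventually_lyapunov hε).mono fun _ hK =>
    Matrix.isExpStable_of_lyapunov (exampleLyapunov_posDef hε) hK

theorem examplePlant_W_posSemidef (ε : ℝ) : (examplePlant ε).W.PosSemidef := by
  refine .of_dotProduct_mulVec_nonneg ?_ fun v => ?_
  · ext i j
    fin_cases i <;> fin_cases j <;> simp [examplePlant]
  · have heq : v ⬝ᵥ (examplePlant ε).W *ᵥ v = 3 * v 0 ^ 2 + 3 * ((1 + ε) * v 1) ^ 2 +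
        (v 0 + (1 + ε) * v 1) ^ 2 := by
      simp [examplePlant, Matrix.mulVec, dotProduct, Fin.sum_univ_two]
      ring
    rw [star_trivial, heq]
    positivity

theorem examplePlant_V_posSemidef (ε : ℝ) : (examplePlant ε).V.PosSemidef :=
  Matrix.PosSemidef.one

/-! ### Criticality, Hessian values and normal directions at the optimal controller -/

variable (z₀ : EuclideanSpace ℝ (Fin 2 ⊕ Fin 2))

theorem example_contDiffAt_cost {ε : ℝ} (hε : 0 < ε) {k : WithTop ℕ∞} :
    ContDiffAt ℝ k ((examplePlant ε).cost z₀) (exampleK ε) :=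
  LQGData.contDiffAt_cost (examplePlant_W_posSemidef ε) (examplePlant_V_posSemidef ε) z₀
    (example_eventually_isExpStable hε)

theorem example_hess_eq_iteratedDeriv {ε : ℝ} (hε : 0 < ε)
    (Δ : Controller (Fin 1) (Fin 1) (Fin 2)) :
    (examplePlant ε).hess z₀ (exampleK ε) Δ Δ =
      iteratedDeriv 2 (fun t : ℝ => (examplePlant ε).cost z₀ (exampleK ε + t • Δ)) 0 :=
  (example_contDiffAt_cost z₀ hε).fderiv_fderiv_apply_self

theorem example_fderiv_cost {ε : ℝ} (hε : 0 < ε) :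
    fderiv ℝ ((examplePlant ε).cost z₀) (exampleK ε) = 0 := by
  ext Δ : 1
  have hstab := example_eventually_isExpStable hε
  -- The first derivative does not involve `X₁`, so its existence is enough for a general direction.
  obtain ⟨X₁, hX₁⟩ := hstab.self_of_nhds.exists_sylvester hstab.self_of_nhds.transpose
    ((examplePlant ε).closedLoopDir Δ * exampleCov ε +
      exampleCov ε * ((examplePlant ε).closedLoopDir Δ)ᵀ +
      (examplePlant ε).noiseDir (exampleK ε) Δ)
  have h := (LQGData.cost_line_derivs (examplePlant_W_posSemidef ε) (examplePlant_V_posSemidef ε)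
    z₀ hstab (exampleCov_lyapunov hε) (exampleDual_lyapunov hε) hX₁).1
  rw [example_gradient_trace hε] at h
  exact (example_contDiffAt_cost z₀ hε).hasDerivAt_line.unique h

theorem example_hess₀ {ε : ℝ} (hε : 0 < ε) :
    (examplePlant ε).hess z₀ (exampleK ε) exampleΔ₀ exampleΔ₀ =
      3 * ε ^ 4 / (875 * ((2 + ε) ^ 3 * (1 + ε))) := by
  rw [example_hess_eq_iteratedDeriv z₀ hε, (LQGData.cost_line_derivs (examplePlant_W_posSemidef ε)
    (examplePlant_V_posSemidef ε) z₀ (example_eventually_isExpStable hε) (exampleCov_lyapunov hε)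
    (exampleDual_lyapunov hε) (exampleCovDir₀_lyapunov hε)).2, example_hessian_trace₀ hε]

theorem example_hess₁ {ε : ℝ} (hε : 0 < ε) :
    (examplePlant ε).hess z₀ (exampleK ε) exampleΔ₁ exampleΔ₁ =
      (1360000 + 3400000 * ε + 3138280 * ε ^ 2 + 1316860 * ε ^ 3 + 239410 * ε ^ 4 +
        12691 * ε ^ 5) / (85750 * ((2 + ε) ^ 3 * (1 + ε))) := by
  rw [example_hess_eq_iteratedDeriv z₀ hε, (LQGData.cost_line_derivs (examplePlant_W_posSemidef ε)
    (examplePlant_V_posSemidef ε) z₀ (example_eventually_isExpStable hε) (exampleCov_lyapunov hε)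
    (exampleDual_lyapunov hε) (exampleCovDir₁_lyapunov hε)).2, example_hessian_trace₁ hε]

/-- The optimal controller is controllable, so the tangent space of its orbit is explicit. -/
theorem example_orbitTangent_le {ε : ℝ} (hε : 0 < ε) : orbitTangent (exampleK ε) ≤
    LinearMap.range (Controller.orbitDifferential (exampleK ε)) := by
  have h1 : 1 + ε ≠ 0 := by positivity
  have h0 : ε ≠ 0 := hε.ne'
  -- The rows `F`, `G` form the inverse of the controllability matrix `[B_K, A_K B_K]`, whose
  -- determinant is `-3/2 * (1 + ε) * ε`; this is where `ε ≠ 0` is essential.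
  refine Controller.orbitTangent_le_range
    (F := !![(2 * (1 + ε) + 7 / 2 * (1 + ε) ^ 2) / (3 / 2 * (1 + ε) * ε),
      -(7 / 2 + 2 * (1 + ε)) / (3 / 2 * (1 + ε) * ε)])
    (G := !![(1 + ε) / (3 / 2 * (1 + ε) * ε), -1 / (3 / 2 * (1 + ε) * ε)]) ?_
  rw [exampleK_eq ε hε, Controller.BK_ofBlocks, Controller.AK_ofBlocks]
  ext i j
  fin_cases i <;> fin_cases j <;>
    simp [Matrix.mul_apply, Matrix.vecMul, dotProduct, Matrix.vecHead, Matrix.vecTail,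
      -mul_eq_zero] <;>
    field_simp <;> ring

/-- The `A_K` block of a tangent vector is a commutator and has trace `0`, whereas that of `Δ₀` has
trace `-1`. -/
theorem exampleΔ₀_notMem_orbitTangent {ε : ℝ} (hε : 0 < ε) :
    exampleΔ₀ ∉ orbitTangent (exampleK ε) := by
  intro h
  obtain ⟨H, hH⟩ := example_orbitTangent_le hε h
  have htr := congrArg (fun K : Controller (Fin 1) (Fin 1) (Fin 2) => K.AK.trace) hH
  simp only [Controller.orbitDifferential_apply, exampleΔ₀, Controller.AK_ofBlocks,
    Matrix.trace_sub, Matrix.trace_mul_comm H, sub_self, Matrix.trace_fin_two_of] at htr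
  norm_num at htr

/-- A direction whose multiple `ε u` has the same projection to the tangent space as `Δ₀`. -/
def exampleU : Controller (Fin 1) (Fin 1) (Fin 2) :=
  Controller.ofBlocks !![7 / 4, 0] !![-7 / 4; 0] !![0, -1 / 2; 0, 0]

/-- A triple `(c, b, a)` is orthogonal to the range of the differential iff `b Bᵀ - Cᵀ c + a Aᵀ - Aᵀ
a = 0`, with `A`, `B`, `C` the blocks of `K*`. For `Δ₀` the left side is exactly `ε` times a fixed
matrix, and `exampleU` is chosen to produce that matrix. -/
theorem exampleΔ₀_sub_mem_orthogonal {ε : ℝ} (hε : 0 < ε) :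
    exampleΔ₀ - ε • exampleU ∈ (orbitTangent (exampleK ε))ᗮ := by
  refine Submodule.orthogonal_le (example_orbitTangent_le hε) ?_
  rw [Submodule.mem_orthogonal]
  rintro _ ⟨H, rfl⟩
  rw [exampleK_eq ε hε, Controller.orbitDifferential_apply, Controller.CK_ofBlocks,
    Controller.BK_ofBlocks, Controller.AK_ofBlocks]
  simp [PiLp.inner_apply, Fintype.sum_sum_type, Fintype.sum_prod_type, Fin.sum_univ_two,
    Controller.ofBlocks, exampleΔ₀, exampleU, Matrix.mul_apply,
    Matrix.vecMul, dotProduct]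
  ring

/-- The projections of `Δ₀` and `ε • exampleU` agree, and projections do not increase norms. -/
theorem norm_starProjection_exampleΔ₀_le {ε : ℝ} (hε : 0 < ε) :
    ‖(orbitTangent (exampleK ε)).starProjection exampleΔ₀‖ ≤ ε * ‖exampleU‖ := by
  have h := (Submodule.starProjection_apply_eq_zero_iff _).2 (exampleΔ₀_sub_mem_orthogonal hε)
  rw [map_sub, sub_eq_zero] at h
  rw [h]
  refine (Submodule.norm_starProjection_apply_le _ _).trans_eq ?_
  rw [norm_smul, Real.norm_of_nonneg hε.le]

theorem norm_exampleΔ₀ : ‖exampleΔ₀‖ ^ 2 = 1 := by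
  rw [EuclideanSpace.real_norm_sq_eq]
  simp [Fintype.sum_sum_type, Fintype.sum_prod_type, Controller.ofBlocks, exampleΔ₀]
  norm_num

theorem norm_exampleΔ₁ : ‖exampleΔ₁‖ ^ 2 = 1 := by
  rw [EuclideanSpace.real_norm_sq_eq]
  simp [Fintype.sum_sum_type, Fintype.sum_prod_type, Controller.ofBlocks, exampleΔ₁]
  norm_num

end

/-! ## The example: asymptotics and condition number -/

theorem isLittleO_sub_const_mul {l : Filter ℝ} {F c G : ℝ → ℝ} {c₀ : ℝ}
    (hF : ∀ᶠ ε in l, F ε = c ε * G ε) (hc : Tendsto c l (𝓝 c₀)) :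
    (fun ε => F ε - c₀ * G ε) =o[l] G := by
  have h1 : (fun ε => c ε - c₀) =o[l] fun _ => (1 : ℝ) :=
    (isLittleO_one_iff ℝ).2 (by simpa using hc.sub_const c₀)
  have h2 := h1.mul_isBigO (isBigO_refl G l)
  simp only [one_mul] at h2
  refine h2.congr' (hF.mono fun ε hε => ?_) .rfl
  simp only [hε, sub_mul]

section Example

variable (z₀ : EuclideanSpace ℝ (Fin 2 ⊕ Fin 2))

theorem example_hess₁_pos {ε : ℝ} (hε : 0 < ε) :
    0 < (examplePlant ε).hess z₀ (exampleK ε) exampleΔ₁ exampleΔ₁ := by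
  rw [example_hess₁ z₀ hε]
  positivity

/-- Tangent vectors lie in the kernel of the Hessian, which is positive on `Δ₁`. -/
theorem exampleΔ₁_notMem_orbitTangent {ε : ℝ} (hε : 0 < ε) :
    exampleΔ₁ ∉ orbitTangent (exampleK ε) := fun h =>
  (example_hess₁_pos 0 hε).ne' (LQGData.hess_orbitTangent_left (examplePlant_W_posSemidef ε)
    (examplePlant_V_posSemidef ε) (example_eventually_isExpStable hε) (example_fderiv_cost 0 hε) h _)

theorem tendsto_norm_starProjection_exampleΔ₀ :
    Tendsto (fun ε : ℝ => ‖(orbitTangent (exampleK ε)).starProjection exampleΔ₀‖) (𝓝[>] 0)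
      (𝓝 0) := by
  have hlim : Tendsto (fun ε : ℝ => ε * ‖exampleU‖) (𝓝[>] 0) (𝓝 0) := by
    have h : Tendsto (fun ε : ℝ => ε * ‖exampleU‖) (𝓝 0) (𝓝 (0 * ‖exampleU‖)) :=
      (continuous_id.mul continuous_const).tendsto 0
    rw [zero_mul] at h
    exact h.mono_left nhdsWithin_le_nhds
  refine squeeze_zero' (Eventually.of_forall fun _ => norm_nonneg _) ?_ hlim
  filter_upwards [self_mem_nhdsWithin] with ε hε
  exact norm_starProjection_exampleΔ₀_le hε

theorem example_normalRayleigh_bounds {ε : ℝ} (hε : 0 < ε) :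
    IsLeast ((examplePlant ε).normalRayleigh z₀ (exampleK ε))
      (sInf ((examplePlant ε).normalRayleigh z₀ (exampleK ε))) ∧
    IsGreatest ((examplePlant ε).normalRayleigh z₀ (exampleK ε))
      (sSup ((examplePlant ε).normalRayleigh z₀ (exampleK ε))) ∧
    0 < ‖exampleΔ₀‖ ^ 2 - ‖(orbitTangent (exampleK ε)).starProjection exampleΔ₀‖ ^ 2 ∧
    sInf ((examplePlant ε).normalRayleigh z₀ (exampleK ε)) ≤
      (examplePlant ε).hess z₀ (exampleK ε) exampleΔ₀ exampleΔ₀ /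
        (‖exampleΔ₀‖ ^ 2 - ‖(orbitTangent (exampleK ε)).starProjection exampleΔ₀‖ ^ 2) ∧
    (examplePlant ε).hess z₀ (exampleK ε) exampleΔ₁ exampleΔ₁ / ‖exampleΔ₁‖ ^ 2 ≤
      sSup ((examplePlant ε).normalRayleigh z₀ (exampleK ε)) ∧
    0 < sSup ((examplePlant ε).normalRayleigh z₀ (exampleK ε)) := by
  obtain ⟨hcompact, hne⟩ := LQGData.normalRayleigh_compact (D := examplePlant ε) (z₀ := z₀)
    (exampleΔ₀_notMem_orbitTangent hε)
  have hleast := hcompact.isLeast_sInf hne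
  have hgreatest := hcompact.isGreatest_sSup hne
  have hmem {Δ : Controller (Fin 1) (Fin 1) (Fin 2)} (hΔ : Δ ∉ orbitTangent (exampleK ε)) :=
    LQGData.rayleigh_mem_normalRayleigh (examplePlant_W_posSemidef ε) (examplePlant_V_posSemidef ε)
      (example_eventually_isExpStable hε) (example_fderiv_cost z₀ hε) hΔ
  obtain ⟨hpos₀, hmem₀⟩ := hmem (exampleΔ₀_notMem_orbitTangent hε)
  obtain ⟨hpos₁, hmem₁⟩ := hmem (exampleΔ₁_notMem_orbitTangent hε)
  have hhess := example_hess₁_pos z₀ hε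
  have hmax : (examplePlant ε).hess z₀ (exampleK ε) exampleΔ₁ exampleΔ₁ / ‖exampleΔ₁‖ ^ 2 ≤
      sSup ((examplePlant ε).normalRayleigh z₀ (exampleK ε)) := by
    refine le_trans ?_ (hgreatest.2 hmem₁)
    -- Omitting the projection enlarges the denominator of a quotient with nonnegative numerator.
    exact div_le_div_of_nonneg_left hhess.le hpos₁ (sub_le_self _ (sq_nonneg _))
  refine ⟨hleast, hgreatest, hpos₀, hleast.2 hmem₀, hmax, lt_of_lt_of_le ?_ hmax⟩
  rw [norm_exampleΔ₁, div_one]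
  exact hhess

theorem tendsto_example_hess₀_coeff :
    Tendsto (fun ε : ℝ => 3 / (875 * ((2 + ε) ^ 3 * (1 + ε)))) (𝓝[>] 0) (𝓝 (3 / 7000)) := by
  have h : ContinuousAt (fun ε : ℝ => 3 / (875 * ((2 + ε) ^ 3 * (1 + ε)))) 0 := by
    refine ContinuousAt.div (by fun_prop) (by fun_prop) (by norm_num)
  have h' := h.tendsto
  norm_num at h'
  exact h'.mono_left nhdsWithin_le_nhds

theorem tendsto_example_hess₁ :
    Tendsto (fun ε : ℝ => (examplePlant ε).hess z₀ (exampleK ε) exampleΔ₁ exampleΔ₁) (𝓝[>] 0)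
      (𝓝 (680 / 343)) := by
  have h : ContinuousAt (fun ε : ℝ => (1360000 + 3400000 * ε + 3138280 * ε ^ 2 + 1316860 * ε ^ 3 +
      239410 * ε ^ 4 + 12691 * ε ^ 5) / (85750 * ((2 + ε) ^ 3 * (1 + ε)))) 0 := by
    refine ContinuousAt.div (by fun_prop) (by fun_prop) (by norm_num)
  have h' := h.tendsto
  norm_num at h'
  refine (h'.mono_left nhdsWithin_le_nhds).congr' ?_
  filter_upwards [self_mem_nhdsWithin] with ε hε
  exact (example_hess₁ z₀ hε).symm

theorem tendsto_example_rayleigh₀_coeff :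
    Tendsto (fun ε : ℝ => 3 / (875 * ((2 + ε) ^ 3 * (1 + ε))) /
      (‖exampleΔ₀‖ ^ 2 - ‖(orbitTangent (exampleK ε)).starProjection exampleΔ₀‖ ^ 2)) (𝓝[>] 0)
      (𝓝 (3 / 7000)) := by
  have h := tendsto_example_hess₀_coeff.div
    ((tendsto_norm_starProjection_exampleΔ₀.pow 2).const_sub (‖exampleΔ₀‖ ^ 2))
    (by rw [norm_exampleΔ₀]; norm_num)
  norm_num [norm_exampleΔ₀] at h ⊢
  exact h

theorem example_rayleigh₀_eq {ε : ℝ} (hε : 0 < ε) :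
    (examplePlant ε).hess z₀ (exampleK ε) exampleΔ₀ exampleΔ₀ /
        (‖exampleΔ₀‖ ^ 2 - ‖(orbitTangent (exampleK ε)).starProjection exampleΔ₀‖ ^ 2) =
      3 / (875 * ((2 + ε) ^ 3 * (1 + ε))) /
        (‖exampleΔ₀‖ ^ 2 - ‖(orbitTangent (exampleK ε)).starProjection exampleΔ₀‖ ^ 2) *
        ε ^ 4 := by
  rw [example_hess₀ z₀ hε]
  ring

theorem example_rcond_le {ε : ℝ} (hε : 0 < ε) : (examplePlant ε).rcond z₀ (exampleK ε) ≤
    3 / (875 * ((2 + ε) ^ 3 * (1 + ε))) /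
      (‖exampleΔ₀‖ ^ 2 - ‖(orbitTangent (exampleK ε)).starProjection exampleΔ₀‖ ^ 2) /
      (examplePlant ε).hess z₀ (exampleK ε) exampleΔ₁ exampleΔ₁ * ε ^ 4 := by
  obtain ⟨-, -, hpos, hmin, hmax, hsup⟩ := example_normalRayleigh_bounds z₀ hε
  rw [norm_exampleΔ₁, div_one] at hmax
  rw [div_mul_eq_mul_div, ← example_rayleigh₀_eq z₀ hε]
  have hnonneg : 0 ≤ (examplePlant ε).hess z₀ (exampleK ε) exampleΔ₀ exampleΔ₀ := by
    rw [example_hess₀ z₀ hε]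
    positivity
  exact div_le_div₀ (div_nonneg hnonneg hpos.le) hmin (example_hess₁_pos z₀ hε) hmax

end Example

theorem mainTheorem10 (z₀ : EuclideanSpace ℝ (Fin 2 ⊕ Fin 2)) :
    -- for every `ε > 0`: the cost is a genuine limit around `K*` and is smooth there
    (∀ ε : ℝ, 0 < ε →
      (∀ᶠ K in 𝓝 (exampleK ε), K ∈ (examplePlant ε).stabilizing ∧
        Tendsto ((examplePlant ε).averageCost z₀ K) atTop (𝓝 ((examplePlant ε).cost z₀ K))) ∧
      ContDiffAt ℝ ∞ ((examplePlant ε).cost z₀) (exampleK ε)) ∧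
    -- the Hessian along `Δ₀` and `Δ₁` as a second derivative along a line
    (∀ ε : ℝ, 0 < ε →
      (examplePlant ε).hess z₀ (exampleK ε) exampleΔ₀ exampleΔ₀ =
        iteratedDeriv 2 (fun t : ℝ => (examplePlant ε).cost z₀ (exampleK ε + t • exampleΔ₀)) 0 ∧
      (examplePlant ε).hess z₀ (exampleK ε) exampleΔ₁ exampleΔ₁ =
        iteratedDeriv 2 (fun t : ℝ => (examplePlant ε).cost z₀ (exampleK ε + t • exampleΔ₁)) 0) ∧
    -- asymptotics of the Hessian along `Δ₀` and `Δ₁`, and of the projection of `Δ₀`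
    (fun ε : ℝ => (examplePlant ε).hess z₀ (exampleK ε) exampleΔ₀ exampleΔ₀ - 3 / 7000 * ε ^ 4)
      =o[𝓝[>] 0] (fun ε : ℝ => ε ^ 4) ∧
    (fun ε : ℝ => (examplePlant ε).hess z₀ (exampleK ε) exampleΔ₁ exampleΔ₁ - 680 / 343)
      =o[𝓝[>] 0] (fun _ : ℝ => (1 : ℝ)) ∧
    (fun ε : ℝ => ‖(orbitTangent (exampleK ε)).starProjection exampleΔ₀‖)
      =O[𝓝[>] 0] (fun ε : ℝ => ε) ∧
    -- the minimum and the maximum on the normal space are attained, and their bounds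
    (∀ ε : ℝ, 0 < ε →
      IsLeast ((examplePlant ε).normalRayleigh z₀ (exampleK ε))
        (sInf ((examplePlant ε).normalRayleigh z₀ (exampleK ε))) ∧
      IsGreatest ((examplePlant ε).normalRayleigh z₀ (exampleK ε))
        (sSup ((examplePlant ε).normalRayleigh z₀ (exampleK ε))) ∧
      0 < ‖exampleΔ₀‖ ^ 2 - ‖(orbitTangent (exampleK ε)).starProjection exampleΔ₀‖ ^ 2 ∧
      sInf ((examplePlant ε).normalRayleigh z₀ (exampleK ε)) ≤
        (examplePlant ε).hess z₀ (exampleK ε) exampleΔ₀ exampleΔ₀ /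
          (‖exampleΔ₀‖ ^ 2 - ‖(orbitTangent (exampleK ε)).starProjection exampleΔ₀‖ ^ 2) ∧
      (examplePlant ε).hess z₀ (exampleK ε) exampleΔ₁ exampleΔ₁ / ‖exampleΔ₁‖ ^ 2 ≤
        sSup ((examplePlant ε).normalRayleigh z₀ (exampleK ε)) ∧
      0 < sSup ((examplePlant ε).normalRayleigh z₀ (exampleK ε))) ∧
    (fun ε : ℝ => (examplePlant ε).hess z₀ (exampleK ε) exampleΔ₀ exampleΔ₀ /
        (‖exampleΔ₀‖ ^ 2 - ‖(orbitTangent (exampleK ε)).starProjection exampleΔ₀‖ ^ 2) -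
        3 / 7000 * ε ^ 4)
      =o[𝓝[>] 0] (fun ε : ℝ => ε ^ 4) ∧
    (fun ε : ℝ => (examplePlant ε).hess z₀ (exampleK ε) exampleΔ₁ exampleΔ₁ / ‖exampleΔ₁‖ ^ 2 -
        680 / 343)
      =o[𝓝[>] 0] (fun _ : ℝ => (1 : ℝ)) ∧
    -- the bound on the reciprocal condition number
    (∃ r : ℝ → ℝ, r =o[𝓝[>] 0] (fun ε : ℝ => ε ^ 4) ∧
      ∀ ε : ℝ, 0 < ε →
        (examplePlant ε).rcond z₀ (exampleK ε) ≤ 147 / 680000 * ε ^ 4 + r ε) := by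
  have hpos : ∀ᶠ ε : ℝ in 𝓝[>] 0, 0 < ε := self_mem_nhdsWithin
  refine ⟨fun ε hε => ⟨?_, example_contDiffAt_cost z₀ hε⟩, fun ε hε =>
    ⟨example_hess_eq_iteratedDeriv z₀ hε _, example_hess_eq_iteratedDeriv z₀ hε _⟩,
    ?_, ?_, ?_, fun ε hε => example_normalRayleigh_bounds z₀ hε, ?_, ?_, ?_⟩
  · filter_upwards [example_eventually_lyapunov hε, example_eventually_isExpStable hε]
      with K hlyap hK
    refine ⟨fun μ hμ =>
      Matrix.re_neg_of_mem_spectrum_of_lyapunov (exampleLyapunov_posDef hε) hlyap hμ, ?_⟩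
    have hX := hK.lyapunovSol_spec ((examplePlant ε).noiseIntensity K)
    rw [LQGData.cost_eq_trace (examplePlant_W_posSemidef ε) (examplePlant_V_posSemidef ε) z₀ hK hX]
    exact LQGData.tendsto_averageCost (examplePlant_W_posSemidef ε) (examplePlant_V_posSemidef ε)
      z₀ hK hX
  · refine isLittleO_sub_const_mul (hpos.mono fun ε hε => ?_) tendsto_example_hess₀_coeff
    rw [example_hess₀ z₀ hε]
    ring
  · refine (isLittleO_one_iff ℝ).2 ?_
    simpa using (tendsto_example_hess₁ z₀).sub_const (680 / 343)
  · refine IsBigO.of_bound ‖exampleU‖ (hpos.mono fun ε hε => ?_)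
    rw [norm_norm, Real.norm_of_nonneg hε.le, mul_comm]
    exact norm_starProjection_exampleΔ₀_le hε
  · exact isLittleO_sub_const_mul (hpos.mono fun ε hε => example_rayleigh₀_eq z₀ hε)
      tendsto_example_rayleigh₀_coeff
  · refine (isLittleO_one_iff ℝ).2 ?_
    simpa [norm_exampleΔ₁] using (tendsto_example_hess₁ z₀).sub_const (680 / 343)
  · have hlim := tendsto_example_rayleigh₀_coeff.div (tendsto_example_hess₁ z₀) (by norm_num)
    rw [show (3 / 7000 : ℝ) / (680 / 343) = 147 / 680000 by norm_num] at hlim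
    have hsmall := isLittleO_sub_const_mul (G := fun ε : ℝ => ε ^ 4)
      (Eventually.of_forall fun ε => rfl) hlim
    -- The remainder is the positive part of the excess of `rcond`: the inequality then holds for
    -- every `ε`, and for `ε > 0` the explicit bound of `example_rcond_le` controls its size.
    refine ⟨fun ε => max ((examplePlant ε).rcond z₀ (exampleK ε) - 147 / 680000 * ε ^ 4) 0,
      IsBigO.trans_isLittleO (IsBigO.of_bound 1 (hpos.mono fun ε hε => ?_)) hsmall,
      fun ε _ => ?_⟩
    · rw [one_mul, Real.norm_of_nonneg (le_max_right _ _)]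
      exact max_le ((sub_le_sub_right (example_rcond_le z₀ hε) _).trans (le_abs_self _))
        (norm_nonneg _)
    · have h := le_max_left ((examplePlant ε).rcond z₀ (exampleK ε) - 147 / 680000 * ε ^ 4) 0
      linarith
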